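/- Let $\mathcal M$ be a smooth, compact, simply connected surface without boundary, equipped with a smooth Riemannian metric $g$, let $\varepsilon>0$ with $\varepsilon\neq 1$, and for $u=(u_1,u_2):\mathcal M\to\mathbb R^2$ put $$e_\varepsilon(u)=\frac{|\nabla_g u|^2}{2}+\frac{(1-|u|^2)^2}{4\varepsilon^2},\qquad |\nabla_g u|^2=\sum_{i=1}^2\langle\nabla_g u_i,\nabla_g u_i\rangle_g .$$ Let $v:\mathcal M\times[0,\infty)\to\mathbb R^2$ be a classical solution of the rescaled Ginzburg-Landau heat flow $$\frac{1}{|\ln\varepsilon|}\,v_t-\Delta_{\mathcal M}v=\frac{v}{\varepsilon^2}\,(1-|v|^2)\ \text{ in }\mathcal M\times(0,\infty),\qquad v(\cdot,0)=u_0,$$ that is, $v$ is continuous on $\mathcal M\times[0,\infty)$ and $C^2$ on $\mathcal M\times(0,\infty)$; here $\Delta_{\mathcal M}$ is the Laplace-Beltrami operator, applied to each component. Let $\eta:\mathcal M\to\mathbb R$ be any smooth function. Then for every $t>0$ the function $\int_{\mathcal M}\eta\,e_\varepsilon(v)\,dv_g$ of time is differentiable at $t$, all the integrands below are integrable, and $$\frac{d}{dt}\int_{\mathcal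 M}\eta\,e_\varepsilon(v)\,dv_g=|\ln\varepsilon|\int_{\mathcal M}\Big[\langle(\mathrm{Hess}\,\eta)(\nabla_g v),\nabla_g v\rangle_g-(\Delta_{\mathcal M}\eta)\,e_\varepsilon(v)\Big]dv_g-\frac{1}{|\ln\varepsilon|}\int_{\mathcal M}\eta\,|v_t|^2\,dv_g ,$$ where $\langle(\mathrm{Hess}\,\eta)(\nabla_g v),\nabla_g v\rangle_g=\sum_{i=1}^2\langle\nabla_{\nabla_g v_i}\nabla_g\eta,\nabla_g v_i\rangle_g$ with $\nabla$ the Levi-Civita connection of $g$. -/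

import Mathlib

open Bundle MeasureTheory Set
open scoped Manifold ContDiff Bundle

noncomputable section

namespace Riem

section Connection

variable {E : Type*} [NormedAddCommGroup E] [NormedSpace ℝ E]
  {H : Type*} [TopologicalSpace H] {I : ModelWithCorners ℝ E H}
  {M : Type*} [TopologicalSpace M] [ChartedSpace H M] [IsManifold I ∞ M]

/-- A smooth Riemannian metric on the manifold `M`. -/
abbrev SmoothMetric (I : ModelWithCorners ℝ E H) (M : Type*) [TopologicalSpace M] [ChartedSpace H M]
    [IsManifold I ∞ M] :=
  ContMDiffRiemannianMetric I ∞ E (fun x : M => TangentSpace I x)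

variable (g : SmoothMetric I M)

theorem mdifferentiableAt_inner {X Y : Π x : M, TangentSpace I x} {p : M}
    (hX : MDiffAt (T% X) p) (hY : MDiffAt (T% Y) p) :
    MDiffAt (fun x => g.inner x (X x) (Y x)) p := by
  have : MDifferentiableAt I (I.prod 𝓘(ℝ))
      (fun m ↦ TotalSpace.mk' ℝ (E := Bundle.Trivial M ℝ) m (g.inner m (X m) (Y m))) p := by
    apply MDifferentiableAt.clm_bundle_apply₂ (F₁ := E) (F₂ := E)
    · exact (g.contMDiff p).mdifferentiableAt (by simp)
    · exact hX
    · exact hY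
  simp only [mdifferentiableAt_totalSpace] at this
  exact this.2

/-- The right-hand side of the Koszul formula, equal to `2 ⟨∇_X Y, Z⟩` at the point `p`. -/
def koszul (X Y Z : Π x : M, TangentSpace I x) (p : M) : ℝ :=
  mvfderiv I (fun x => g.inner x (Y x) (Z x)) p (X p)
    + mvfderiv I (fun x => g.inner x (X x) (Z x)) p (Y p)
    - mvfderiv I (fun x => g.inner x (X x) (Y x)) p (Z p)
    + g.inner p (VectorField.mlieBracket I X Y p) (Z p)
    - g.inner p (VectorField.mlieBracket I X Z p) (Y p)
    - g.inner p (VectorField.mlieBracket I Y Z p) (X p)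

theorem mvfderiv_inner_smul_left {f : M → ℝ} {X Y : Π x : M, TangentSpace I x} {p : M}
    (hf : MDiffAt f p) (hX : MDiffAt (T% X) p) (hY : MDiffAt (T% Y) p) :
    mvfderiv I (fun x => g.inner x ((f • X) x) (Y x)) p
      = f p • mvfderiv I (fun x => g.inner x (X x) (Y x)) p
        + (g.inner p (X p) (Y p)) • mvfderiv I f p := by
  simpa using mvfderiv_fun_mul hf (mdifferentiableAt_inner g hX hY)

theorem mvfderiv_inner_add_left {X X' Y : Π x : M, TangentSpace I x} {p : M}
    (hX : MDiffAt (T% X) p) (hX' : MDiffAt (T% X') p) (hY : MDiffAt (T% Y) p) :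
    mvfderiv I (fun x => g.inner x ((X + X') x) (Y x)) p
      = mvfderiv I (fun x => g.inner x (X x) (Y x)) p
        + mvfderiv I (fun x => g.inner x (X' x) (Y x)) p := by
  simpa using mvfderiv_fun_add (mdifferentiableAt_inner g hX hY) (mdifferentiableAt_inner g hX' hY)

theorem inner_comm_fun (X Y : Π x : M, TangentSpace I x) :
    (fun x => g.inner x (X x) (Y x)) = fun x => g.inner x (Y x) (X x) :=
  funext fun x => g.symm x (X x) (Y x)

theorem koszul_tensorial_left [CompleteSpace E] {Y Z : Π x : M, TangentSpace I x} {p : M}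
    (hY : MDiffAt (T% Y) p) (hZ : MDiffAt (T% Z) p) :
    TensorialAt I E (fun X : Π x : M, TangentSpace I x => koszul g X Y Z p) p where
  smul {f X} hf hX := by
    simp only [koszul, mvfderiv_inner_smul_left g hf hX hZ, mvfderiv_inner_smul_left g hf hX hY,
      VectorField.mlieBracket_smul_left hf hX]
    simp
    ring
  add {X X'} hX hX' := by
    simp only [koszul, mvfderiv_inner_add_left g hX hX' hZ, mvfderiv_inner_add_left g hX hX' hY,
      VectorField.mlieBracket_add_left hX hX']
    simp
    ring

theorem koszul_tensorial_right [CompleteSpace E] {X Y : Π x : M, TangentSpace I x} {p : M}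
    (hX : MDiffAt (T% X) p) (hY : MDiffAt (T% Y) p) :
    TensorialAt I E (fun Z : Π x : M, TangentSpace I x => koszul g X Y Z p) p where
  smul {f Z} hf hZ := by
    simp only [koszul, inner_comm_fun g Y, inner_comm_fun g X (f • Z), inner_comm_fun g X Z,
      mvfderiv_inner_smul_left g hf hZ hX, mvfderiv_inner_smul_left g hf hZ hY,
      VectorField.mlieBracket_smul_right hf hZ]
    simp [g.symm p (Z p)]
    ring
  add {Z Z'} hZ hZ' := by
    simp only [koszul, inner_comm_fun g Y, inner_comm_fun g X (Z + Z'), inner_comm_fun g X Z,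
      inner_comm_fun g X Z',
      mvfderiv_inner_add_left g hZ hZ' hX, mvfderiv_inner_add_left g hZ hZ' hY,
      VectorField.mlieBracket_add_right hZ hZ']
    simp
    ring

theorem koszul_smul_middle [CompleteSpace E] {f : M → ℝ} {X Y Z : Π x : M, TangentSpace I x} {p : M}
    (hf : MDiffAt f p)
    (hX : MDiffAt (T% X) p) (hY : MDiffAt (T% Y) p) (hZ : MDiffAt (T% Z) p) :
    koszul g X (f • Y) Z p
      = f p * koszul g X Y Z p + 2 * (mvfderiv I f p (X p) * g.inner p (Y p) (Z p)) := by
  simp only [koszul, inner_comm_fun g X (f • Y), inner_comm_fun g X Y,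
    mvfderiv_inner_smul_left g hf hY hZ, mvfderiv_inner_smul_left g hf hY hX,
    VectorField.mlieBracket_smul_right hf hY, VectorField.mlieBracket_smul_left hf hY]
  simp [g.symm p (Y p) (X p)]
  ring

theorem koszul_add_middle [CompleteSpace E] {X Y Y' Z : Π x : M, TangentSpace I x} {p : M}
    (hX : MDiffAt (T% X) p) (hY : MDiffAt (T% Y) p) (hY' : MDiffAt (T% Y') p)
    (hZ : MDiffAt (T% Z) p) :
    koszul g X (Y + Y') Z p = koszul g X Y Z p + koszul g X Y' Z p := by
  simp only [koszul, inner_comm_fun g X,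
    mvfderiv_inner_add_left g hY hY' hZ, mvfderiv_inner_add_left g hY hY' hX,
    VectorField.mlieBracket_add_right hY hY', VectorField.mlieBracket_add_left hY hY']
  simp
  ring

/-- The Riemannian inner product on the tangent space at `p`, as a bilinear form. -/
def bilin (p : M) : LinearMap.BilinForm ℝ (TangentSpace I p) :=
  LinearMap.mk₂ ℝ (fun X Y => g.inner p X Y) (by simp) (by simp) (by simp) (by simp)

theorem bilin_nondegenerate (p : M) : (bilin g p).Nondegenerate := by
  constructor
  · intro X hX
    by_contra h
    exact (g.pos p X h).ne' (hX X)
  · intro X hX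
    by_contra h
    exact (g.pos p X h).ne' (hX X)

theorem ext_inner {p : M} {X Y : TangentSpace I p}
    (h : ∀ Z : TangentSpace I p, g.inner p X Z = g.inner p Y Z) : X = Y := by
  by_contra hne
  have h1 := g.pos p (X - Y) (sub_ne_zero.2 hne)
  have h2 := h (X - Y)
  simp only [map_sub, sub_apply] at h1 h2
  linarith

variable [FiniteDimensional ℝ E]

instance (p : M) : FiniteDimensional ℝ (TangentSpace I p) :=
  inferInstanceAs (FiniteDimensional ℝ E)

instance (p : M) : T2Space (TangentSpace I p) :=
  inferInstanceAs (T2Space E)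

/-- The tangent vector at `p` representing the linear form `φ`: `⟨sharp φ, Z⟩ = φ Z`. -/
def sharp (p : M) (φ : TangentSpace I p →L[ℝ] ℝ) : TangentSpace I p :=
  ((bilin g p).toDual (bilin_nondegenerate g p)).symm φ

theorem inner_sharp (p : M) (φ : TangentSpace I p →L[ℝ] ℝ) (Z : TangentSpace I p) :
    g.inner p (sharp g p φ) Z = φ Z :=
  (bilin g p).apply_toDual_symm_apply (hB := bilin_nondegenerate g p) (f := φ) (v := Z)

/-- The Koszul expression as a bilinear form in `(X, Z)` on the tangent space at `p`, for a vector
field `Y` that is differentiable at `p`. -/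
def koszulForm [CompleteSpace E] (Y : Π x : M, TangentSpace I x) (p : M) (hY : MDiffAt (T% Y) p) :
    TangentSpace I p →L[ℝ] TangentSpace I p →L[ℝ] ℝ :=
  TensorialAt.mkHom₂ (I := I) (F := E) (F' := E) (fun X Z => koszul g X Y Z p) p
    (fun _ hZ => koszul_tensorial_left g hY hZ) (fun _ hX => koszul_tensorial_right g hX hY)

open Classical in
/-- The covariant derivative `X ↦ ∇_X Y` at `p`, determined by
`2 ⟨∇_X Y, Z⟩ = koszul X Y Z`. Where `Y` is not differentiable it is set to zero. -/
def nabla [CompleteSpace E] (Y : Π x : M, TangentSpace I x) (p : M) :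
    TangentSpace I p →L[ℝ] TangentSpace I p :=
  if hY : MDiffAt (T% Y) p then
    LinearMap.toContinuousLinearMap
      { toFun := fun X => sharp g p ((1 / 2 : ℝ) • koszulForm g Y p hY X)
        map_add' := fun X X' => ext_inner g fun Z => by simp [inner_sharp]
        map_smul' := fun c X => ext_inner g fun Z => by simp [inner_sharp, mul_left_comm] }
  else 0

theorem inner_nabla [CompleteSpace E] {X Y Z : Π x : M, TangentSpace I x} {p : M}
    (hX : MDiffAt (T% X) p) (hY : MDiffAt (T% Y) p) (hZ : MDiffAt (T% Z) p) :
    g.inner p (nabla g Y p (X p)) (Z p) = 1 / 2 * koszul g X Y Z p := by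
  have h : koszulForm g Y p hY (X p) (Z p) = koszul g X Y Z p :=
    TensorialAt.mkHom₂_apply (I := I) (F := E) (F' := E) (Φ := fun X Z => koszul g X Y Z p) _ _ hX hZ
  simp [nabla, hY, inner_sharp, h]

theorem ext_nabla {p : M} {A B : TangentSpace I p →L[ℝ] TangentSpace I p}
    (h : ∀ X Z : Π x : M, TangentSpace I x, MDiffAt (T% X) p → MDiffAt (T% Z) p →
      g.inner p (A (X p)) (Z p) = g.inner p (B (X p)) (Z p)) : A = B := by
  ext1 X₀
  refine ext_inner g fun Z₀ => ?_
  simpa using h (FiberBundle.extend E X₀) (FiberBundle.extend E Z₀)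
    (FiberBundle.mdifferentiableAt_extend ..) (FiberBundle.mdifferentiableAt_extend ..)

/-- The Levi-Civita connection of the metric `g`. -/
def leviCivita [CompleteSpace E] :
    CovariantDerivative I E (fun x : M => TangentSpace I x) where
  toFun := nabla g
  isCovariantDerivativeOnUniv :=
    { add := fun {Y Y' p} hY hY' _ => ext_nabla g fun X Z hX hZ => by
        have hYY : MDiffAt (T% (Y + Y')) p := mdifferentiableAt_add_section hY hY'
        simp [inner_nabla g hX hYY hZ, inner_nabla g hX hY hZ, inner_nabla g hX hY' hZ,
          koszul_add_middle g hX hY hY' hZ]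
        ring
      leibniz := fun {Y f p} hY hf _ => ext_nabla g fun X Z hX hZ => by
        have hfY : MDiffAt (T% (f • Y)) p := hf.smul_section hY
        simp [inner_nabla g hX hfY hZ, inner_nabla g hX hY hZ,
          koszul_smul_middle g hf hX hY hZ]
        ring }

theorem leviCivita_metric [CompleteSpace E] {X Y Z : Π x : M, TangentSpace I x} {p : M}
    (hX : MDiffAt (T% X) p) (hY : MDiffAt (T% Y) p) (hZ : MDiffAt (T% Z) p) :
    mvfderiv I (fun x => g.inner x (Y x) (Z x)) p (X p)
      = g.inner p (leviCivita g Y p (X p)) (Z p) + g.inner p (Y p) (leviCivita g Z p (X p)) := by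
  change _ = g.inner p (nabla g Y p (X p)) (Z p) + g.inner p (Y p) (nabla g Z p (X p))
  rw [g.symm p (Y p), inner_nabla g hX hY hZ, inner_nabla g hX hZ hY]
  simp only [koszul, inner_comm_fun g Z Y, VectorField.mlieBracket_swap_apply (V := Z) (W := Y)]
  simp
  ring

theorem leviCivita_torsion [CompleteSpace E] : (leviCivita g).torsion = 0 := by
  rw [CovariantDerivative.torsion_eq_zero_iff]
  intro X Y p hX hY
  change nabla g Y p (X p) - nabla g X p (Y p) = _
  refine ext_inner g fun Z₀ => ?_
  have hZ := FiberBundle.mdifferentiableAt_extend I E Z₀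
  have h1 := inner_nabla g hX hY hZ
  have h2 := inner_nabla g hY hX hZ
  simp only [FiberBundle.extend_apply_self] at h1 h2
  simp only [map_sub, sub_apply, h1, h2]
  simp only [koszul, inner_comm_fun g Y X, VectorField.mlieBracket_swap_apply (V := Y) (W := X)]
  simp
  ring

/-- The Riemannian gradient: `⟨grad f, Z⟩ = df(Z)`. -/
def grad (f : M → ℝ) (p : M) : TangentSpace I p :=
  sharp g p (mvfderiv I f p)

/-- The Hessian of `f` at `p` as the endomorphism `X ↦ ∇_X (grad f)`. -/
def hess [CompleteSpace E] (f : M → ℝ) (p : M) : TangentSpace I p →L[ℝ] TangentSpace I p :=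
  leviCivita g (grad g f) p

/-- The Laplace-Beltrami operator, the trace of the Hessian. -/
def laplace [CompleteSpace E] (f : M → ℝ) (p : M) : ℝ :=
  LinearMap.trace ℝ (TangentSpace I p) (hess g f p : TangentSpace I p →ₗ[ℝ] TangentSpace I p)

end Connection

section Volume

variable {n : ℕ} {M : Type*} [TopologicalSpace M] [ChartedSpace (EuclideanSpace ℝ (Fin n)) M]
  [IsManifold (𝓡 n) ∞ M] (g : SmoothMetric (𝓡 n) M)

/-- The coordinate vector field `∂ᵢ` of the chart at `c`, at the point with coordinates `y`. -/
def coordVec (c : M) (y : EuclideanSpace ℝ (Fin n)) (i : Fin n) :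
    TangentSpace (𝓡 n) ((chartAt (EuclideanSpace ℝ (Fin n)) c).symm y) :=
  mfderiv (𝓡 n) (𝓡 n) (chartAt (EuclideanSpace ℝ (Fin n)) c).symm y
    (EuclideanSpace.single i (1 : ℝ))

/-- The density `√(det (gᵢⱼ))` in the chart at `c`, at the point with coordinates `y`. -/
def coordDensity (c : M) (y : EuclideanSpace ℝ (Fin n)) : ℝ :=
  √(Matrix.of fun i j : Fin n => g.inner ((chartAt (EuclideanSpace ℝ (Fin n)) c).symm y)
    (coordVec c y i) (coordVec c y j)).det

variable (n M) in
/-- A smooth partition of unity subordinate to the chart domains. -/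
def chartPartition [T2Space M] [SigmaCompactSpace M] : SmoothPartitionOfUnity M (𝓡 n) M univ :=
  (SmoothPartitionOfUnity.exists_isSubordinate_chartAt_source (𝓡 n) M).choose

variable (n M) in
theorem chartPartition_isSubordinate [T2Space M] [SigmaCompactSpace M] :
    (chartPartition n M).IsSubordinate
      fun c => (chartAt (EuclideanSpace ℝ (Fin n)) c).source :=
  (SmoothPartitionOfUnity.exists_isSubordinate_chartAt_source (𝓡 n) M).choose_spec

variable [MeasurableSpace M]

/-- The Riemannian measure of the domain of the chart at `c`: the image under the inverse chart of
the measure `√(det (gᵢⱼ)) dy` on the range of the chart. -/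
def chartVolume (c : M) : Measure M :=
  (((volume : Measure (EuclideanSpace ℝ (Fin n))).restrict
      (chartAt (EuclideanSpace ℝ (Fin n)) c).target).withDensity
        fun y => ENNReal.ofReal (coordDensity g c y)).map
    (chartAt (EuclideanSpace ℝ (Fin n)) c).symm

/-- The Riemannian volume measure, glued from the chart measures by a partition of unity. -/
def vol [T2Space M] [SigmaCompactSpace M] : Measure M :=
  Measure.sum fun c : M =>
    (chartVolume g c).withDensity fun p => ENNReal.ofReal (chartPartition n M c p)

end Volume

section GinzburgLandau

variable {M : Type*} [TopologicalSpace M] [ChartedSpace (EuclideanSpace ℝ (Fin 2)) M]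
  [IsManifold (𝓡 2) ∞ M] (g : SmoothMetric (𝓡 2) M)

/-- `|∇u|² = |∇u₁|² + |∇u₂|²` for a map `u = (u₁, u₂)` into the plane. -/
def gradSq (u : M → EuclideanSpace ℝ (Fin 2)) (p : M) : ℝ :=
  ∑ i, g.inner p (grad g (fun x => u x i) p) (grad g (fun x => u x i) p)

/-- `⟨(Hess η)(∇u), ∇u⟩`, summed over the components of `u`. -/
def hessGrad (η : M → ℝ) (u : M → EuclideanSpace ℝ (Fin 2)) (p : M) : ℝ :=
  ∑ i, g.inner p (hess g η p (grad g (fun x => u x i) p)) (grad g (fun x => u x i) p)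

/-- The Laplace-Beltrami operator applied to each component of a map into the plane. -/
def vecLaplace (u : M → EuclideanSpace ℝ (Fin 2)) (p : M) : EuclideanSpace ℝ (Fin 2) :=
  WithLp.toLp 2 fun i => laplace g (fun x => u x i) p

/-- The Ginzburg-Landau energy density `|∇u|² / 2 + (1 - |u|²)² / (4 ε²)`. -/
def energyDensity (ε : ℝ) (u : M → EuclideanSpace ℝ (Fin 2)) (p : M) : ℝ :=
  gradSq g u p / 2 + (1 - ‖u p‖ ^ 2) ^ 2 / (4 * ε ^ 2)

/-- `v` is a classical solution on `M × (0, ∞)` of the rescaled Ginzburg-Landau heat flow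
`|ln ε|⁻¹ v_t - Δ v = ε⁻² (1 - |v|²) v` with initial data `u₀`. -/
structure IsRescaledGLSolution (ε : ℝ) (u₀ : M → EuclideanSpace ℝ (Fin 2))
    (v : ℝ → M → EuclideanSpace ℝ (Fin 2)) : Prop where
  contMDiffOn : ContMDiffOn (𝓘(ℝ, ℝ).prod (𝓡 2)) 𝓘(ℝ, EuclideanSpace ℝ (Fin 2)) 2
    (fun q : ℝ × M => v q.1 q.2) (Ioi 0 ×ˢ univ)
  continuousOn : ContinuousOn (fun q : ℝ × M => v q.1 q.2) (Ici 0 ×ˢ univ)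
  initial : v 0 = u₀
  equation : ∀ t : ℝ, 0 < t → ∀ p : M,
    (1 / |Real.log ε|) • deriv (fun s => v s p) t - vecLaplace g (v t) p
      = ((1 - ‖v t p‖ ^ 2) / ε ^ 2) • v t p

end GinzburgLandau

end Riem

end

/-!
The statement is the localized energy identity of the flow. Write `e` for the energy density,
`κ = ε⁻² (1 - |v|²)` and `L = |ln ε|`. Differentiating under the integral sign
(`hasDerivAt_integral_scalarEnergy`) gives
`d/dt ∫ η e = ∫ η ∑ᵢ (⟨∇vᵢ, ∇∂ₜvᵢ⟩ - κ vᵢ ∂ₜvᵢ)`. The right-hand side is then rewritten with three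
instances of Green's identity `∫ (h Δw + ⟨∇h, ∇w⟩) = 0` (`integral_green`), valid for `h` of class
`C¹` and `w` of class `C²`, which is all the regularity that is available:

* `(h, w) = (η ∂ₜvᵢ, vᵢ)` moves the derivative off `∂ₜvᵢ`; with the flow equation this leaves
  `-L⁻¹ ∫ η |∂ₜv|² - ∫ ∑ᵢ ∂ₜvᵢ ⟨∇η, ∇vᵢ⟩`;
* `(h, w) = (⟨∇η, ∇vᵢ⟩, vᵢ)` and `(h, w) = (e, η)` express that the stress-energy tensor has
  divergence `∑ᵢ (Δvᵢ + κ vᵢ) ∇vᵢ = L⁻¹ ∑ᵢ ∂ₜvᵢ ∇vᵢ`. Here the terms `Hess vᵢ (∇η, ∇vᵢ)` cancel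
  because the Hessian is symmetric (`inner_hess_comm`).

The combination is carried out in `integral_energy_derivative`.

Green's identity is reduced by a partition of unity to `h` supported in a chart domain. There
`√D Δw = ∂ᵢ (√D gⁱʲ ∂ⱼw)` (`coordDensity_mul_laplace`, obtained from the Koszul formula for the
commuting coordinate fields), so the integrand is the Euclidean divergence of a compactly supported
`C¹` field. That the glued volume measure agrees with `√D dy` on every chart domain
(`vol_restrict_source`) is the change of variables formula for the transition maps.
-/

local notation "𝔼" => EuclideanSpace ℝ (Fin 2)

noncomputable section

namespace Riem

/-! ### Coordinate vector fields -/

section Frame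

variable {M : Type*} [TopologicalSpace M] [ChartedSpace 𝔼 M] [IsManifold (𝓡 2) ∞ M]

/-- The coordinate vector field `∂ᵢ` of the chart at `c`, as a vector field on the manifold.
It is meaningful on the domain of the chart only. -/
def frameVec (c : M) (i : Fin 2) (p : M) : TangentSpace (𝓡 2) p :=
  (trivializationAt 𝔼 (TangentSpace (𝓡 2)) c).symmL ℝ p (EuclideanSpace.single i (1 : ℝ))

theorem mdifferentiableAt_chartAt_symm {c : M} {y : 𝔼} (hy : y ∈ (chartAt 𝔼 c).target) :
    MDifferentiableAt (𝓡 2) (𝓡 2) (chartAt 𝔼 c).symm y :=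
  (mdifferentiable_chart (I := 𝓡 2) c).mdifferentiableAt_symm hy

theorem mdifferentiableAt_chartAt {c p : M} (hp : p ∈ (chartAt 𝔼 c).source) :
    MDifferentiableAt (𝓡 2) (𝓡 2) (chartAt 𝔼 c) p :=
  (mdifferentiable_chart (I := 𝓡 2) c).mdifferentiableAt hp

theorem frameVec_eq_mfderiv {c p : M} (hp : p ∈ (chartAt 𝔼 c).source) (i : Fin 2) :
    frameVec c i p = mfderiv (𝓡 2) (𝓡 2) (chartAt 𝔼 c).symm (chartAt 𝔼 c p)
      (EuclideanSpace.single i (1 : ℝ)) := by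
  rw [frameVec, TangentBundle.symmL_trivializationAt hp]
  simp
  rfl

theorem frameVec_chart_symm {c : M} {y : 𝔼} (hy : y ∈ (chartAt 𝔼 c).target) (i : Fin 2) :
    frameVec c i ((chartAt 𝔼 c).symm y) = coordVec c y i := by
  have h := frameVec_eq_mfderiv ((chartAt 𝔼 c).map_target hy) i
  -- The tangent space varies with `z`, so the base point is replaced in the model space.
  have h2 : ∀ z, z = y → (mfderiv (𝓡 2) (𝓡 2) (chartAt 𝔼 c).symm z
      (EuclideanSpace.single i (1 : ℝ)) : 𝔼) = mfderiv (𝓡 2) (𝓡 2) (chartAt 𝔼 c).symm y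
      (EuclideanSpace.single i (1 : ℝ)) := by
    rintro z rfl; rfl
  exact h.trans (h2 _ ((chartAt 𝔼 c).right_inv hy))

theorem contMDiffOn_frameVec (c : M) (i : Fin 2) :
    ContMDiffOn (𝓡 2) (𝓡 2).tangent ∞ (T% (frameVec c i)) (chartAt 𝔼 c).source := by
  have h := (trivializationAt 𝔼 (TangentSpace (𝓡 2)) c).contMDiffOn_section_baseSet_iff
    (IB := 𝓡 2) (n := ∞) (s := frameVec c i)
  refine h.2 ?_
  refine (contMDiffOn_const (c := (EuclideanSpace.single i (1 : ℝ) : 𝔼))).congr ?_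
  intro y hy
  simp only [frameVec, Trivialization.symmL_apply _ hy]
  rw [Trivialization.apply_mk_symm _ hy]

theorem mdifferentiableAt_frameVec {c p : M} (hp : p ∈ (chartAt 𝔼 c).source) (i : Fin 2) :
    MDifferentiableAt (𝓡 2) (𝓡 2).tangent (T% (frameVec c i)) p :=
  ((contMDiffOn_frameVec c i).contMDiffAt ((chartAt 𝔼 c).open_source.mem_nhds hp)).mdifferentiableAt
    (by simp)

/-- The coordinate vector fields span each tangent space over the chart domain. -/
theorem frameVec_linearCombination {c p : M} (hp : p ∈ (chartAt 𝔼 c).source)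
    (X : TangentSpace (𝓡 2) p) :
    ∃ a : Fin 2 → ℝ, X = ∑ i, a i • frameVec c i p := by
  let e := (trivializationAt 𝔼 (TangentSpace (𝓡 2)) c)
  have hp' : p ∈ e.baseSet := hp
  have h := e.symmL_continuousLinearMapAt (R := ℝ) hp' X
  set y : 𝔼 := e.continuousLinearMapAt ℝ p X
  refine ⟨fun i => y i, ?_⟩
  have hy : y = ∑ i, y i • (EuclideanSpace.single i (1 : ℝ) : 𝔼) := by
    ext j; fin_cases j <;> simp
  rw [hy, map_sum] at h
  simp only [map_smul] at h
  exact h.symm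

theorem frameVec_linearIndependent {c p : M} (hp : p ∈ (chartAt 𝔼 c).source) {a : Fin 2 → ℝ}
    (h : ∑ i, a i • frameVec c i p = 0) (i : Fin 2) : a i = 0 := by
  let e := (trivializationAt 𝔼 (TangentSpace (𝓡 2)) c)
  have hp' : p ∈ e.baseSet := hp
  have h1 : ∀ i, e.continuousLinearMapAt ℝ p (frameVec c i p) = EuclideanSpace.single i (1 : ℝ) :=
    fun i => e.continuousLinearMapAt_symmL (R := ℝ) hp' _
  have h2 := congrArg (e.continuousLinearMapAt ℝ p) h
  simp only [map_sum, map_smul, h1, map_zero] at h2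
  have h3 := congrArg (fun z : 𝔼 => z i) h2
  fin_cases i <;> simpa using h3

/-- In the chart, `∂ᵢ` acts on functions as the `i`-th partial derivative. -/
theorem mvfderiv_frameVec {c : M} {y : 𝔼} (hy : y ∈ (chartAt 𝔼 c).target) {f : M → ℝ}
    (hf : MDifferentiableAt (𝓡 2) 𝓘(ℝ, ℝ) f ((chartAt 𝔼 c).symm y)) (i : Fin 2) :
    mvfderiv (𝓡 2) f ((chartAt 𝔼 c).symm y) (frameVec c i ((chartAt 𝔼 c).symm y)) =
      fderiv ℝ (fun z => f ((chartAt 𝔼 c).symm z)) y (EuclideanSpace.single i (1 : ℝ)) := by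
  rw [frameVec_chart_symm hy]
  have h := mvfderiv_comp_apply (I' := 𝓡 2) y hf (mdifferentiableAt_chartAt_symm hy)
    (EuclideanSpace.single i (1 : ℝ))
  refine h.symm.trans ?_
  simp [mvfderiv, mfderiv_eq_fderiv]
  rfl

theorem mfderiv_chartAt_frameVec {c p : M} (hp : p ∈ (chartAt 𝔼 c).source) (i : Fin 2) :
    mfderiv (𝓡 2) (𝓡 2) (chartAt 𝔼 c) p (frameVec c i p) = EuclideanSpace.single i (1 : ℝ) := by
  let e := (trivializationAt 𝔼 (TangentSpace (𝓡 2)) c)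
  have hp' : p ∈ e.baseSet := hp
  have h1 : e.continuousLinearMapAt ℝ p (frameVec c i p) = EuclideanSpace.single i (1 : ℝ) :=
    e.continuousLinearMapAt_symmL (R := ℝ) hp' _
  rw [TangentBundle.continuousLinearMapAt_trivializationAt hp] at h1
  exact h1

/-- Coordinate vector fields commute: they are the pullbacks under the chart of constant fields. -/
theorem mlieBracket_frameVec {c p : M} (hp : p ∈ (chartAt 𝔼 c).source) (i j : Fin 2) :
    VectorField.mlieBracket (𝓡 2) (frameVec c i) (frameVec c j) p = 0 := by
  have : IsManifold (𝓡 2) (minSmoothness ℝ 2) M :=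
    IsManifold.of_le (n := ∞) (by simpa using ENat.LEInfty.out)
  let V : Fin 2 → Π y : 𝔼, TangentSpace (𝓡 2) y := fun i _ => EuclideanSpace.single i (1 : ℝ)
  have hV : ∀ i (y : 𝔼), MDifferentiableAt (𝓡 2) (𝓡 2).tangent (T% (V i)) y := by
    intro i y
    have : ContDiffAt ℝ 1 (V i) y := contDiffAt_const
    exact (contMDiffAt_vectorSpace_iff_contDiffAt.2 this).mdifferentiableAt (by simp)
  have key : ∀ i, VectorField.mpullback (𝓡 2) (𝓡 2) (chartAt 𝔼 c) (V i) =ᶠ[nhds p]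
      frameVec c i := by
    intro i
    filter_upwards [(chartAt 𝔼 c).open_source.mem_nhds hp] with q hq
    have hinv : (mfderiv (𝓡 2) (𝓡 2) (chartAt 𝔼 c) q).IsInvertible :=
      isInvertible_mfderiv_extChartAt (I := 𝓡 2) (x := c) (by simpa using hq)
    rw [VectorField.mpullback_apply]
    exact (hinv.inverse_apply_eq).2 (mfderiv_chartAt_frameVec hq i).symm
  have hb := VectorField.mpullback_mlieBracket (I := 𝓡 2) (I' := 𝓡 2) (x₀ := p) (n := ∞)
    (f := chartAt 𝔼 c) (hV i (chartAt 𝔼 c p)) (hV j _)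
    ((contMDiffOn_chart (I := 𝓡 2)).contMDiffAt ((chartAt 𝔼 c).open_source.mem_nhds hp))
    (by simpa using ENat.LEInfty.out)
  rw [(key i).mlieBracket_vectorField_eq (key j)] at hb
  rw [← hb, VectorField.mpullback_apply]
  have : VectorField.mlieBracket (𝓡 2) (V i) (V j) (chartAt 𝔼 c p) = 0 := by
    rw [← VectorField.mlieBracketWithin_univ, VectorField.mlieBracketWithin_eq_lieBracketWithin]
    simp [VectorField.lieBracket, V]
    rfl
  rw [this, map_zero]

end Frame

/-! ### The metric and gradients in coordinates -/

section Coordinates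

variable {M : Type*} [TopologicalSpace M] [ChartedSpace 𝔼 M] [IsManifold (𝓡 2) ∞ M]
  (g : SmoothMetric (𝓡 2) M)

/-- The partial derivative `∂ᵢ F` of a function of two real variables. -/
def pderiv (i : Fin 2) (F : 𝔼 → ℝ) (y : 𝔼) : ℝ :=
  fderiv ℝ F y (EuclideanSpace.single i (1 : ℝ))

/-- The coefficient `gᵢⱼ` of the metric in the chart at `c`. -/
def metricCoeff (c : M) (i j : Fin 2) (y : 𝔼) : ℝ :=
  g.inner ((chartAt 𝔼 c).symm y) (coordVec c y i) (coordVec c y j)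

/-- The determinant of the matrix `(gᵢⱼ)` in the chart at `c`. -/
def metricDet (c : M) (y : 𝔼) : ℝ :=
  metricCoeff g c 0 0 y * metricCoeff g c 1 1 y - metricCoeff g c 0 1 y ^ 2

theorem metricCoeff_symm (c : M) (i j : Fin 2) (y : 𝔼) :
    metricCoeff g c i j y = metricCoeff g c j i y :=
  g.symm _ _ _

theorem coordDensity_eq (c : M) (y : 𝔼) : coordDensity g c y = √(metricDet g c y) := by
  simp only [coordDensity, Matrix.det_fin_two, Matrix.of_apply, metricDet]
  rw [← metricCoeff, ← metricCoeff, ← metricCoeff, ← metricCoeff, metricCoeff_symm g c 1 0, sq]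

theorem inner_frameVec {c : M} {y : 𝔼} (hy : y ∈ (chartAt 𝔼 c).target) (i j : Fin 2) :
    g.inner ((chartAt 𝔼 c).symm y) (frameVec c i ((chartAt 𝔼 c).symm y))
      (frameVec c j ((chartAt 𝔼 c).symm y)) = metricCoeff g c i j y := by
  rw [frameVec_chart_symm hy, frameVec_chart_symm hy, metricCoeff]

theorem contDiffOn_metricCoeff (c : M) (i j : Fin 2) :
    ContDiffOn ℝ ∞ (metricCoeff g c i j) (chartAt 𝔼 c).target := by
  have h1 : ContMDiffOn (𝓡 2) 𝓘(ℝ, ℝ) ∞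
      (fun p => g.inner p (frameVec c i p) (frameVec c j p)) (chartAt 𝔼 c).source := by
    have : ContMDiffOn (𝓡 2) ((𝓡 2).prod 𝓘(ℝ)) ∞
        (fun m ↦ TotalSpace.mk' ℝ (E := Bundle.Trivial M ℝ) m
          (g.inner m (frameVec c i m) (frameVec c j m))) (chartAt 𝔼 c).source := by
      apply ContMDiffOn.clm_bundle_apply₂ (F₁ := 𝔼) (F₂ := 𝔼)
      · exact g.contMDiff.contMDiffOn
      · exact contMDiffOn_frameVec c i
      · exact contMDiffOn_frameVec c j
    intro p hp
    have h2 := this p hp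
    rw [contMDiffWithinAt_totalSpace] at h2
    exact h2.2
  have h2 := h1.comp (contMDiffOn_chart_symm (I := 𝓡 2) (n := ∞) (x := c))
    (chartAt 𝔼 c).mapsTo_symm
  refine (contMDiffOn_iff_contDiffOn.1 h2).congr fun y hy => ?_
  exact (inner_frameVec g hy i j).symm

theorem metricDet_pos {c : M} {y : 𝔼} (hy : y ∈ (chartAt 𝔼 c).target) :
    0 < metricDet g c y := by
  set p := (chartAt 𝔼 c).symm y
  have hps : p ∈ (chartAt 𝔼 c).source := (chartAt 𝔼 c).map_target hy
  have hne : ∀ a : Fin 2 → ℝ, (a 0 ≠ 0 ∨ a 1 ≠ 0) → 0 < g.inner p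
      (∑ i, a i • frameVec c i p) (∑ i, a i • frameVec c i p) := by
    intro a ha
    refine g.pos p _ fun h0 => ?_
    have := frameVec_linearIndependent hps h0
    simp [this] at ha
  -- Sylvester's criterion by hand: test positivity on `∂₀` and on `g₀₀ ∂₁ - g₀₁ ∂₀`.
  have h1 := hne ![1, 0] (by simp)
  have h2 := hne ![-metricCoeff g c 0 1 y, metricCoeff g c 0 0 y]
  have hin : ∀ i j, g.inner p (frameVec c i p) (frameVec c j p) = metricCoeff g c i j y :=
    inner_frameVec g hy
  simp only [Fin.sum_univ_two, map_add, map_smul, add_apply, smul_apply,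
    smul_eq_mul, hin, Matrix.cons_val_zero, Matrix.cons_val_one,
    metricCoeff_symm g c 1 0] at h1 h2
  have h3 : 0 < metricCoeff g c 0 0 y := by linarith
  have h4 := h2 (Or.inr h3.ne')
  have h5 : 0 < metricCoeff g c 0 0 y * metricDet g c y := by
    rw [metricDet]; linarith
  exact pos_of_mul_pos_right h5 h3.le

theorem contDiffOn_metricDet (c : M) : ContDiffOn ℝ ∞ (metricDet g c) (chartAt 𝔼 c).target :=
  ((contDiffOn_metricCoeff g c 0 0).mul (contDiffOn_metricCoeff g c 1 1)).sub
    ((contDiffOn_metricCoeff g c 0 1).pow 2)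

/-- The components `gⁱʲ ∂ⱼF` of the gradient of `F` in the chart at `c`. -/
def coordGrad (c : M) (F : 𝔼 → ℝ) (i : Fin 2) (y : 𝔼) : ℝ :=
  ![(metricCoeff g c 1 1 y * pderiv 0 F y - metricCoeff g c 0 1 y * pderiv 1 F y) / metricDet g c y,
    (metricCoeff g c 0 0 y * pderiv 1 F y - metricCoeff g c 0 1 y * pderiv 0 F y) / metricDet g c y]
    i

theorem sum_coordGrad_mul_metricCoeff {c : M} {y : 𝔼} (hy : y ∈ (chartAt 𝔼 c).target)
    (F : 𝔼 → ℝ) (j : Fin 2) :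
    ∑ i, coordGrad g c F i y * metricCoeff g c i j y = pderiv j F y := by
  have h := (metricDet_pos g hy).ne'
  fin_cases j <;> simp [coordGrad, metricCoeff_symm g c 1 0] <;> field_simp <;>
    rw [metricDet] <;> ring

theorem inner_grad (f : M → ℝ) (p : M) (X : TangentSpace (𝓡 2) p) :
    g.inner p (grad g f p) X = mvfderiv (𝓡 2) f p X :=
  inner_sharp g p _ X

theorem inner_ext_frameVec {c p : M} (hp : p ∈ (chartAt 𝔼 c).source) {X Y : TangentSpace (𝓡 2) p}
    (h : ∀ i, g.inner p X (frameVec c i p) = g.inner p Y (frameVec c i p)) : X = Y := by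
  refine ext_inner g fun Z => ?_
  obtain ⟨a, rfl⟩ := frameVec_linearCombination hp Z
  simp [h]

theorem grad_eq_sum_frameVec {c : M} {y : 𝔼} (hy : y ∈ (chartAt 𝔼 c).target) {f : M → ℝ}
    (hf : MDifferentiableAt (𝓡 2) 𝓘(ℝ, ℝ) f ((chartAt 𝔼 c).symm y)) :
    grad g f ((chartAt 𝔼 c).symm y) =
      ∑ i, coordGrad g c (fun z => f ((chartAt 𝔼 c).symm z)) i y •
        frameVec c i ((chartAt 𝔼 c).symm y) := by
  refine inner_ext_frameVec g ((chartAt 𝔼 c).map_target hy) fun j => ?_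
  rw [inner_grad, mvfderiv_frameVec hy hf]
  change pderiv j _ y = _
  rw [← sum_coordGrad_mul_metricCoeff g hy]
  simp [inner_frameVec g hy]

theorem inner_grad_grad {c : M} {y : 𝔼} (hy : y ∈ (chartAt 𝔼 c).target) {f h : M → ℝ}
    (hf : MDifferentiableAt (𝓡 2) 𝓘(ℝ, ℝ) f ((chartAt 𝔼 c).symm y))
    (hh : MDifferentiableAt (𝓡 2) 𝓘(ℝ, ℝ) h ((chartAt 𝔼 c).symm y)) :
    g.inner ((chartAt 𝔼 c).symm y) (grad g f ((chartAt 𝔼 c).symm y))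
        (grad g h ((chartAt 𝔼 c).symm y)) =
      ∑ i, coordGrad g c (fun z => h ((chartAt 𝔼 c).symm z)) i y *
        pderiv i (fun z => f ((chartAt 𝔼 c).symm z)) y := by
  rw [inner_grad, grad_eq_sum_frameVec g hy hh]
  simp [mvfderiv_frameVec hy hf, pderiv]

/-- A real function is `C^k` on the surface iff its expression in every preferred chart is. -/
theorem contMDiff_iff_contDiffOn_chart {k : ℕ} {f : M → ℝ} :
    ContMDiff (𝓡 2) 𝓘(ℝ, ℝ) k f ↔
      ∀ c : M, ContDiffOn ℝ k (fun y => f ((chartAt 𝔼 c).symm y)) (chartAt 𝔼 c).target := by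
  have hk : (k : ℕ∞ω) ≤ ∞ := by exact ENat.LEInfty.out
  have : IsManifold (𝓡 2) k M := IsManifold.of_le hk
  constructor
  · intro hf c
    exact contMDiffOn_iff_contDiffOn.1
      (hf.comp_contMDiffOn (contMDiffOn_chart_symm (I := 𝓡 2) (n := k) (x := c)))
  · intro h p
    have h1 := (contMDiffOn_iff_contDiffOn.2 (h p)).comp
      (contMDiffOn_chart (I := 𝓡 2) (n := k) (x := p)) (chartAt 𝔼 p).mapsTo
    have h2 := h1.contMDiffAt ((chartAt 𝔼 p).open_source.mem_nhds (mem_chart_source 𝔼 p))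
    refine h2.congr_of_eventuallyEq ?_
    filter_upwards [(chartAt 𝔼 p).open_source.mem_nhds (mem_chart_source 𝔼 p)] with q hq
    simp [hq]

theorem contDiffOn_pderiv {U : Set 𝔼} (hU : IsOpen U) {k : ℕ} {F : 𝔼 → ℝ}
    (hF : ContDiffOn ℝ (k + 1 : ℕ) F U) (i : Fin 2) : ContDiffOn ℝ k (pderiv i F) U :=
  (hF.fderiv_of_isOpen hU (by norm_cast)).clm_apply contDiffOn_const

theorem contDiffOn_coordGrad {c : M} {k : ℕ} {F : 𝔼 → ℝ}
    (hF : ContDiffOn ℝ (k + 1 : ℕ) F (chartAt 𝔼 c).target) (i : Fin 2) :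
    ContDiffOn ℝ k (coordGrad g c F i) (chartAt 𝔼 c).target := by
  have hk : (k : ℕ∞ω) ≤ ∞ := by exact ENat.LEInfty.out
  have hG := fun i j => (contDiffOn_metricCoeff g c i j).of_le hk
  have hD := (contDiffOn_metricDet g c).of_le hk
  have hP := fun i => contDiffOn_pderiv (chartAt 𝔼 c).open_target hF i
  have hD0 : ∀ y ∈ (chartAt 𝔼 c).target, metricDet g c y ≠ 0 := fun y hy =>
    (metricDet_pos g hy).ne'
  fin_cases i
  · exact (((hG 1 1).mul (hP 0)).sub ((hG 0 1).mul (hP 1))).div hD hD0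
  · exact (((hG 0 0).mul (hP 1)).sub ((hG 0 1).mul (hP 0))).div hD hD0

theorem contMDiff_inner_grad_grad {k : ℕ} {f h : M → ℝ}
    (hf : ContMDiff (𝓡 2) 𝓘(ℝ, ℝ) (k + 1 : ℕ) f) (hh : ContMDiff (𝓡 2) 𝓘(ℝ, ℝ) (k + 1 : ℕ) h) :
    ContMDiff (𝓡 2) 𝓘(ℝ, ℝ) k (fun p => g.inner p (grad g f p) (grad g h p)) := by
  rw [contMDiff_iff_contDiffOn_chart]
  intro c
  have h1 := contMDiff_iff_contDiffOn_chart.1 hf c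
  have h2 := contMDiff_iff_contDiffOn_chart.1 hh c
  have h3 : ContDiffOn ℝ k (fun y => ∑ i, coordGrad g c (fun z => h ((chartAt 𝔼 c).symm z)) i y *
        pderiv i (fun z => f ((chartAt 𝔼 c).symm z)) y) (chartAt 𝔼 c).target :=
    ContDiffOn.sum fun i _ => (contDiffOn_coordGrad g h2 i).mul
      (contDiffOn_pderiv (chartAt 𝔼 c).open_target h1 i)
  refine h3.congr fun y hy => ?_
  exact inner_grad_grad g hy (hf.mdifferentiableAt (by simp)) (hh.mdifferentiableAt (by simp))

/-- Near a point of the chart domain, `grad f = ∑ aᵢ ∂ᵢ` with `aᵢ` the coordinate components. -/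
theorem grad_eventuallyEq {c p : M} (hp : p ∈ (chartAt 𝔼 c).source) {f : M → ℝ}
    (hf : MDifferentiable (𝓡 2) 𝓘(ℝ, ℝ) f) :
    ∀ᶠ q in nhds p, grad g f q = (∑ i, (fun q => coordGrad g c
      (fun z => f ((chartAt 𝔼 c).symm z)) i (chartAt 𝔼 c q)) • frameVec c i) q := by
  filter_upwards [(chartAt 𝔼 c).open_source.mem_nhds hp] with q hq
  have h := grad_eq_sum_frameVec g ((chartAt 𝔼 c).map_source hq) (hf _)
  rw [(chartAt 𝔼 c).left_inv hq] at h
  simpa using h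

theorem mdifferentiableAt_comp_chartAt {c p : M} (hp : p ∈ (chartAt 𝔼 c).source) {F : 𝔼 → ℝ}
    (hF : DifferentiableAt ℝ F (chartAt 𝔼 c p)) :
    MDifferentiableAt (𝓡 2) 𝓘(ℝ, ℝ) (fun q => F (chartAt 𝔼 c q)) p :=
  hF.mdifferentiableAt.comp p (mdifferentiableAt_chartAt hp)

theorem mdifferentiableAt_coordGrad_comp {c p : M} (hp : p ∈ (chartAt 𝔼 c).source) {f : M → ℝ}
    (hf : ContMDiff (𝓡 2) 𝓘(ℝ, ℝ) 2 f) (i : Fin 2) :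
    MDifferentiableAt (𝓡 2) 𝓘(ℝ, ℝ) (fun q => coordGrad g c
      (fun z => f ((chartAt 𝔼 c).symm z)) i (chartAt 𝔼 c q)) p := by
  refine mdifferentiableAt_comp_chartAt hp ?_
  have h1 := contMDiff_iff_contDiffOn_chart (k := 2).1 hf c
  have h2 := contDiffOn_coordGrad (k := 1) g h1 i
  exact ((h2.contDiffAt ((chartAt 𝔼 c).open_target.mem_nhds
    ((chartAt 𝔼 c).map_source hp))).differentiableAt (by simp))

theorem mdifferentiableAt_grad {f : M → ℝ} (hf : ContMDiff (𝓡 2) 𝓘(ℝ, ℝ) 2 f) (p : M) :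
    MDifferentiableAt (𝓡 2) (𝓡 2).tangent (T% (grad g f)) p := by
  have hp := mem_chart_source 𝔼 p
  have h1 : MDifferentiableAt (𝓡 2) (𝓡 2).tangent (T% (fun q => ∑ i, ((fun q => coordGrad g p
      (fun z => f ((chartAt 𝔼 p).symm z)) i (chartAt 𝔼 p q)) • frameVec p i) q)) p :=
    .sum_section (fun i _ => (mdifferentiableAt_coordGrad_comp g hp hf i).smul_section
      (mdifferentiableAt_frameVec hp i))
  refine h1.congr_of_eventuallyEq ?_
  filter_upwards [grad_eventuallyEq g hp (hf.mdifferentiable (by simp))] with q hq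
  simp [hq]

end Coordinates

/-! ### The Hessian and the Laplace-Beltrami operator -/

section Hessian

variable {M : Type*} [TopologicalSpace M] [ChartedSpace 𝔼 M] [IsManifold (𝓡 2) ∞ M]
  (g : SmoothMetric (𝓡 2) M)

theorem leviCivita_frameVec_comm {c p : M} (hp : p ∈ (chartAt 𝔼 c).source) (i j : Fin 2) :
    leviCivita g (frameVec c j) p (frameVec c i p) =
      leviCivita g (frameVec c i) p (frameVec c j p) := by
  have h := (CovariantDerivative.torsion_eq_zero_iff (leviCivita g)).1 (leviCivita_torsion g)
    (mdifferentiableAt_frameVec hp i) (mdifferentiableAt_frameVec hp j)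
  rw [mlieBracket_frameVec hp] at h
  exact sub_eq_zero.1 h

/-- `∂ᵢ ⟨grad f, ∂ⱼ⟩` is the second partial derivative `∂ᵢ∂ⱼ f` in the chart. -/
theorem mvfderiv_inner_grad_frameVec {c : M} {y : 𝔼} (hy : y ∈ (chartAt 𝔼 c).target) {f : M → ℝ}
    (hf : ContMDiff (𝓡 2) 𝓘(ℝ, ℝ) 2 f) (i j : Fin 2) :
    mvfderiv (𝓡 2) (fun q => g.inner q (grad g f q) (frameVec c j q)) ((chartAt 𝔼 c).symm y)
        (frameVec c i ((chartAt 𝔼 c).symm y)) =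
      pderiv i (pderiv j (fun z => f ((chartAt 𝔼 c).symm z))) y := by
  have hp := (chartAt 𝔼 c).map_target hy
  rw [mvfderiv_frameVec hy (mdifferentiableAt_inner g (mdifferentiableAt_grad g hf _)
    (mdifferentiableAt_frameVec hp j))]
  have : (fun z => g.inner ((chartAt 𝔼 c).symm z) (grad g f ((chartAt 𝔼 c).symm z))
      (frameVec c j ((chartAt 𝔼 c).symm z))) =ᶠ[nhds y]
      pderiv j (fun z => f ((chartAt 𝔼 c).symm z)) := by
    filter_upwards [(chartAt 𝔼 c).open_target.mem_nhds hy] with z hz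
    rw [inner_grad, mvfderiv_frameVec hz (hf.mdifferentiableAt (by simp)), pderiv]
  rw [this.fderiv_eq, pderiv]

theorem pderiv_comm {U : Set 𝔼} (hU : IsOpen U) {F : 𝔼 → ℝ} (hF : ContDiffOn ℝ 2 F U) {y : 𝔼}
    (hy : y ∈ U) (i j : Fin 2) : pderiv i (pderiv j F) y = pderiv j (pderiv i F) y := by
  have hF' := hF.contDiffAt (hU.mem_nhds hy)
  have h1 : DifferentiableAt ℝ (fderiv ℝ F) y :=
    (hF'.fderiv_right (m := 1) (by norm_num)).differentiableAt (by simp)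
  have h2 := (hF'.isSymmSndFDerivAt (by simp)).eq (EuclideanSpace.single i (1 : ℝ))
    (EuclideanSpace.single j (1 : ℝ))
  have h3 : ∀ i j, pderiv i (pderiv j F) y = fderiv ℝ (fderiv ℝ F) y
      (EuclideanSpace.single i (1 : ℝ)) (EuclideanSpace.single j (1 : ℝ)) := by
    intro i j
    have : pderiv j F = fun z => fderiv ℝ F z (EuclideanSpace.single j (1 : ℝ)) := rfl
    rw [pderiv, this, fderiv_clm_apply h1 (differentiableAt_const _)]
    simp
  rw [h3, h3, h2]

/-- The Hessian of a `C²` function is symmetric, as the Levi-Civita connection is torsion-free. -/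
theorem inner_hess_comm {f : M → ℝ} (hf : ContMDiff (𝓡 2) 𝓘(ℝ, ℝ) 2 f) (p : M)
    (X Y : TangentSpace (𝓡 2) p) :
    g.inner p (hess g f p X) Y = g.inner p (hess g f p Y) X := by
  have key : ∀ (c : M) (y : 𝔼), y ∈ (chartAt 𝔼 c).target →
      ∀ X Y : TangentSpace (𝓡 2) ((chartAt 𝔼 c).symm y),
        g.inner _ (hess g f _ X) Y = g.inner _ (hess g f _ Y) X := by
    intro c y hy X Y
    have hp := (chartAt 𝔼 c).map_target hy
    have hframe : ∀ i j, g.inner _ (hess g f _ (frameVec c i ((chartAt 𝔼 c).symm y)))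
        (frameVec c j _) =
          g.inner ((chartAt 𝔼 c).symm y) (hess g f _ (frameVec c j _)) (frameVec c i _) := by
      intro i j
      -- `⟨∇ᵢ grad f, ∂ⱼ⟩ = ∂ᵢ∂ⱼ f - ⟨grad f, ∇ᵢ ∂ⱼ⟩`, and both terms are symmetric in `i`, `j`.
      have h := fun i j => leviCivita_metric g (X := frameVec c i) (Y := grad g f)
        (Z := frameVec c j) (mdifferentiableAt_frameVec hp i) (mdifferentiableAt_grad g hf _)
        (mdifferentiableAt_frameVec hp j)
      have h1 := fun i j => mvfderiv_inner_grad_frameVec g hy hf i j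
      have h2 := pderiv_comm (chartAt 𝔼 c).open_target
        (contMDiff_iff_contDiffOn_chart (k := 2).1 hf c) hy i j
      have h3 := h i j
      have h4 := h j i
      rw [h1] at h3 h4
      rw [leviCivita_frameVec_comm g hp i j] at h3
      have h5 : ∀ q, hess g f q = leviCivita g (grad g f) q := fun _ => rfl
      rw [h5]
      linarith
    obtain ⟨a, rfl⟩ := frameVec_linearCombination hp X
    obtain ⟨b, rfl⟩ := frameVec_linearCombination hp Y
    simp only [Fin.sum_univ_two, map_add, map_smul, add_apply, smul_apply, smul_eq_mul,
      hframe 0 1]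
    ring
  have h := key p _ (mem_chart_target 𝔼 p)
  rw [(chartAt 𝔼 p).left_inv (mem_chart_source 𝔼 p)] at h
  exact h X Y

theorem mvfderiv_inner_grad_grad {f h : M → ℝ} (hf : ContMDiff (𝓡 2) 𝓘(ℝ, ℝ) 2 f)
    (hh : ContMDiff (𝓡 2) 𝓘(ℝ, ℝ) 2 h) (p : M) (X : TangentSpace (𝓡 2) p) :
    mvfderiv (𝓡 2) (fun q => g.inner q (grad g f q) (grad g h q)) p X =
      g.inner p (hess g f p X) (grad g h p) + g.inner p (grad g f p) (hess g h p X) := by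
  have h1 := leviCivita_metric g (X := FiberBundle.extend 𝔼 X) (Y := grad g f) (Z := grad g h)
    (FiberBundle.mdifferentiableAt_extend ..) (mdifferentiableAt_grad g hf p)
    (mdifferentiableAt_grad g hh p)
  simp only [FiberBundle.extend_apply_self] at h1
  exact h1

/-- The trace of an endomorphism `A` is `gⁱʲ ⟨A ∂ᵢ, ∂ⱼ⟩`. -/
theorem metricDet_mul_trace {c : M} {y : 𝔼} (hy : y ∈ (chartAt 𝔼 c).target)
    (A : TangentSpace (𝓡 2) ((chartAt 𝔼 c).symm y) →ₗ[ℝ]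
      TangentSpace (𝓡 2) ((chartAt 𝔼 c).symm y)) :
    metricDet g c y * LinearMap.trace ℝ _ A =
      metricCoeff g c 1 1 y * g.inner _ (A (frameVec c 0 _)) (frameVec c 0 _) -
        metricCoeff g c 0 1 y * (g.inner _ (A (frameVec c 0 _)) (frameVec c 1 _)
          + g.inner _ (A (frameVec c 1 _)) (frameVec c 0 _)) +
        metricCoeff g c 0 0 y * g.inner _ (A (frameVec c 1 _)) (frameVec c 1 _) := by
  have hin := inner_frameVec g hy
  have hp := (chartAt 𝔼 c).map_target hy
  generalize (chartAt 𝔼 c).symm y = p at *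
  have hli : LinearIndependent ℝ (fun i => frameVec c i p) := by
    rw [Fintype.linearIndependent_iff]
    exact fun a ha i => frameVec_linearIndependent hp ha i
  have hsp : ⊤ ≤ Submodule.span ℝ (Set.range fun i => frameVec c i p) := by
    intro X _
    obtain ⟨a, rfl⟩ := frameVec_linearCombination hp X
    exact Submodule.sum_mem _ fun i _ => Submodule.smul_mem _ _ (Submodule.subset_span ⟨i, rfl⟩)
  let b := Module.Basis.mk hli hsp
  have hb : ∀ i, b i = frameVec c i p := fun i => by simp [b]
  have hA : ∀ j, A (frameVec c j p) = ∑ i, LinearMap.toMatrix b b A i j • frameVec c i p := by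
    intro j
    have h := b.sum_repr (A (b j))
    simp only [hb] at h
    rw [← h]
    simp [LinearMap.toMatrix_apply, hb]
  rw [LinearMap.trace_eq_matrix_trace ℝ b, Matrix.trace_fin_two, hA, hA]
  simp only [Fin.sum_univ_two, map_add, map_smul, add_apply, smul_apply, smul_eq_mul, hin,
    metricCoeff_symm g c 1 0, metricDet]
  ring

/-- The Christoffel symbols of the first kind: in the Koszul formula all brackets vanish. -/
theorem two_mul_inner_leviCivita_frameVec {c : M} {y : 𝔼} (hy : y ∈ (chartAt 𝔼 c).target)
    (i j k : Fin 2) :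
    2 * g.inner _ (leviCivita g (frameVec c k) _ (frameVec c i _))
        (frameVec c j ((chartAt 𝔼 c).symm y)) =
      pderiv i (metricCoeff g c k j) y + pderiv k (metricCoeff g c i j) y
        - pderiv j (metricCoeff g c i k) y := by
  have hp := (chartAt 𝔼 c).map_target hy
  have h := inner_nabla g (mdifferentiableAt_frameVec hp i) (mdifferentiableAt_frameVec hp k)
    (mdifferentiableAt_frameVec hp j)
  have hd : ∀ i j k, mvfderiv (𝓡 2) (fun q => g.inner q (frameVec c i q) (frameVec c j q))
      ((chartAt 𝔼 c).symm y) (frameVec c k _) = pderiv k (metricCoeff g c i j) y := by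
    intro i j k
    rw [mvfderiv_frameVec hy (mdifferentiableAt_inner g (mdifferentiableAt_frameVec hp i)
      (mdifferentiableAt_frameVec hp j)), pderiv]
    congr 1
    refine Filter.EventuallyEq.fderiv_eq ?_
    filter_upwards [(chartAt 𝔼 c).open_target.mem_nhds hy] with z hz
    exact inner_frameVec g hz i j
  change 2 * g.inner _ (nabla g _ _ _) _ = _
  rw [h, koszul, hd, hd, hd, mlieBracket_frameVec hp, mlieBracket_frameVec hp,
    mlieBracket_frameVec hp]
  simp

/-- The Leibniz rule for `∇_X (∑ aᵢ ∂ᵢ)`, where `grad f = ∑ aᵢ ∂ᵢ`. -/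
theorem hess_eq_sum_frameVec {c p : M} (hp : p ∈ (chartAt 𝔼 c).source) {f : M → ℝ}
    (hf : ContMDiff (𝓡 2) 𝓘(ℝ, ℝ) 2 f) (X : TangentSpace (𝓡 2) p) :
    hess g f p X = ∑ i, (coordGrad g c (fun z => f ((chartAt 𝔼 c).symm z)) i (chartAt 𝔼 c p) •
        leviCivita g (frameVec c i) p X +
      mvfderiv (𝓡 2) (fun q => coordGrad g c
        (fun z => f ((chartAt 𝔼 c).symm z)) i (chartAt 𝔼 c q)) p X • frameVec c i p) := by
  have hcov := (leviCivita g).isCovariantDerivativeOn (s := univ)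
  have ha := fun i => mdifferentiableAt_coordGrad_comp g hp hf i
  have hv := fun i => mdifferentiableAt_frameVec hp i
  have hs := fun i => (ha i).smul_section (hv i)
  have h0 := grad_eventuallyEq g hp (hf.mdifferentiable (by simp))
  rw [Fin.sum_univ_two] at h0
  have h1 := hcov.congr_of_eventuallyEq (mdifferentiableAt_grad g hf p)
    (mdifferentiableAt_add_section (hs 0) (hs 1)) Filter.univ_mem h0
  rw [hess, h1, Fin.sum_univ_two]
  rw [hcov.add (hs 0) (hs 1), hcov.leibniz (hv 0) (ha 0), hcov.leibniz (hv 1) (ha 1)]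
  simp

/-- The coordinate expression `√D Δf = ∂ᵢ (√D gⁱʲ ∂ⱼf)` of the Laplace-Beltrami operator. -/
theorem coordDensity_mul_laplace {c : M} {y : 𝔼} (hy : y ∈ (chartAt 𝔼 c).target) {f : M → ℝ}
    (hf : ContMDiff (𝓡 2) 𝓘(ℝ, ℝ) 2 f) :
    coordDensity g c y * laplace g f ((chartAt 𝔼 c).symm y) =
      ∑ i, pderiv i (fun z => coordDensity g c z *
        coordGrad g c (fun z => f ((chartAt 𝔼 c).symm z)) i z) y := by
  have hp := (chartAt 𝔼 c).map_target hy
  have hD := metricDet_pos g hy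
  have hU := (chartAt 𝔼 c).open_target.mem_nhds hy
  have hGd : ∀ i j, DifferentiableAt ℝ (metricCoeff g c i j) y := fun i j =>
    ((contDiffOn_metricCoeff g c i j).contDiffAt hU).differentiableAt (by simp)
  have had : ∀ i, DifferentiableAt ℝ (coordGrad g c (fun z => f ((chartAt 𝔼 c).symm z)) i) y :=
    fun i => ((contDiffOn_coordGrad (k := 1) g
      (contMDiff_iff_contDiffOn_chart (k := 2).1 hf c) i).contDiffAt hU).differentiableAt (by simp)
  set a := coordGrad g c (fun z => f ((chartAt 𝔼 c).symm z)) with ha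
  have hH : ∀ i j, g.inner _ (hess g f ((chartAt 𝔼 c).symm y) (frameVec c i _)) (frameVec c j _) =
      ∑ k, (a k y * ((pderiv i (metricCoeff g c k j) y + pderiv k (metricCoeff g c i j) y
        - pderiv j (metricCoeff g c i k) y) / 2) + pderiv i (a k) y * metricCoeff g c k j y) := by
    intro i j
    rw [hess_eq_sum_frameVec g hp hf]
    simp only [← two_mul_inner_leviCivita_frameVec g hy]
    have h1 : ∀ k, mvfderiv (𝓡 2) (fun q => a k (chartAt 𝔼 c q)) ((chartAt 𝔼 c).symm y)
        (frameVec c i ((chartAt 𝔼 c).symm y)) = pderiv i (a k) y := by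
      intro k
      rw [mvfderiv_frameVec hy (mdifferentiableAt_coordGrad_comp g hp hf k), pderiv]
      congr 1
      refine Filter.EventuallyEq.fderiv_eq ?_
      filter_upwards [hU] with z hz
      simp only [(chartAt 𝔼 c).right_inv hz, ← ha]
    simp only [← ha, h1, (chartAt 𝔼 c).right_inv hy]
    simp [inner_frameVec g hy]
  have htr := metricDet_mul_trace g hy
    (hess g f ((chartAt 𝔼 c).symm y) : TangentSpace (𝓡 2) _ →ₗ[ℝ] TangentSpace (𝓡 2) _)
  simp only [ContinuousLinearMap.coe_coe, hH] at htr
  rw [← laplace] at htr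
  have hDd : DifferentiableAt ℝ (metricDet g c) y :=
    ((contDiffOn_metricDet g c).contDiffAt hU).differentiableAt (by simp)
  have hpD : ∀ k, pderiv k (metricDet g c) y =
      metricCoeff g c 0 0 y * pderiv k (metricCoeff g c 1 1) y
        + metricCoeff g c 1 1 y * pderiv k (metricCoeff g c 0 0) y
        - 2 * metricCoeff g c 0 1 y * pderiv k (metricCoeff g c 0 1) y := by
    intro k
    have := (((hGd 0 0).hasFDerivAt.mul (hGd 1 1).hasFDerivAt).sub
      ((hGd 0 1).hasFDerivAt.pow 2)).fderiv
    have h2 : metricDet g c = (metricCoeff g c 0 0 * metricCoeff g c 1 1 -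
      fun z => metricCoeff g c 0 1 z ^ 2) := rfl
    rw [pderiv, h2, this]
    simp [pderiv]
  have hps : ∀ k, pderiv k (fun z => coordDensity g c z * a k z) y =
      √(metricDet g c y) * pderiv k (a k) y +
        a k y * (pderiv k (metricDet g c) y / (2 * √(metricDet g c y))) := by
    intro k
    have h1 := ((hDd.hasFDerivAt.sqrt hD.ne').mul (had k).hasFDerivAt).fderiv
    have h2 : (fun z => coordDensity g c z * a k z) =
        (fun z => √(metricDet g c z)) * a k := by
      funext z; simp [coordDensity_eq]
    rw [pderiv, h2, h1]
    simp only [pderiv, add_apply, smul_apply, smul_eq_mul]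
    ring
  have hs : metricCoeff g c 1 0 = metricCoeff g c 0 1 := funext fun z => metricCoeff_symm g c 1 0 z
  simp only [hps, Fin.sum_univ_two, hpD]
  simp only [Fin.sum_univ_two, hs] at htr
  rw [coordDensity_eq]
  have hsq := Real.sq_sqrt hD.le
  have hs0 : √(metricDet g c y) ≠ 0 := (Real.sqrt_pos.2 hD).ne'
  field_simp
  rw [hsq]
  have hmd : metricDet g c y = metricCoeff g c 0 0 y * metricCoeff g c 1 1 y -
    metricCoeff g c 0 1 y ^ 2 := rfl
  linear_combination 2 * htr - 2 * (pderiv 0 (a 0) y + pderiv 1 (a 1) y) * hmd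

end Hessian

/-! ### The Riemannian volume -/

section VolumeMeasure

variable {M : Type*} [TopologicalSpace M] [ChartedSpace 𝔼 M] [IsManifold (𝓡 2) ∞ M]
  (g : SmoothMetric (𝓡 2) M)

theorem coordDensity_pos {c : M} {y : 𝔼} (hy : y ∈ (chartAt 𝔼 c).target) :
    0 < coordDensity g c y := by
  rw [coordDensity_eq]
  exact Real.sqrt_pos.2 (metricDet_pos g hy)

theorem contDiffOn_coordDensity (c : M) :
    ContDiffOn ℝ ∞ (coordDensity g c) (chartAt 𝔼 c).target :=
  ((contDiffOn_metricDet g c).sqrt fun _ hy => (metricDet_pos g hy).ne').congr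
    fun y _ => coordDensity_eq g c y

/-- The transition map from the chart at `c` to the chart at `d`, meaningful over the overlap of
their domains. -/
def transition (c d : M) (y : 𝔼) : 𝔼 := chartAt 𝔼 d ((chartAt 𝔼 c).symm y)

theorem det_eq_apply_single (L : 𝔼 →L[ℝ] 𝔼) : L.det =
    L (EuclideanSpace.single 0 1) 0 * L (EuclideanSpace.single 1 1) 1 -
      L (EuclideanSpace.single 1 1) 0 * L (EuclideanSpace.single 0 1) 1 := by
  have h := LinearMap.det_toMatrix (EuclideanSpace.basisFun (Fin 2) ℝ).toBasis (L : 𝔼 →ₗ[ℝ] 𝔼)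
  rw [ContinuousLinearMap.det, ← h, Matrix.det_fin_two]
  simp [LinearMap.toMatrix_apply]

theorem mdifferentiableAt_transition {c d : M} {y : 𝔼} (hy : y ∈ (chartAt 𝔼 c).target)
    (hd : (chartAt 𝔼 c).symm y ∈ (chartAt 𝔼 d).source) :
    MDifferentiableAt (𝓡 2) (𝓡 2) (transition c d) y :=
  (mdifferentiableAt_chartAt hd).comp y (mdifferentiableAt_chartAt_symm hy)

/-- Change of coordinate vector fields: `∂ᵢ = ∑ (∂τₖ/∂yᵢ) ∂'ₖ` with `τ` the transition map. -/
theorem frameVec_eq_sum_frameVec {c d : M} {y : 𝔼} (hy : y ∈ (chartAt 𝔼 c).target)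
    (hd : (chartAt 𝔼 c).symm y ∈ (chartAt 𝔼 d).source) (i : Fin 2) :
    frameVec c i ((chartAt 𝔼 c).symm y) =
      ∑ k, fderiv ℝ (transition c d) y (EuclideanSpace.single i 1) k •
        frameVec d k ((chartAt 𝔼 c).symm y) := by
  obtain ⟨a, ha⟩ := frameVec_linearCombination hd (frameVec c i ((chartAt 𝔼 c).symm y))
  have h1 := congrArg (mfderiv (𝓡 2) (𝓡 2) (chartAt 𝔼 d) ((chartAt 𝔼 c).symm y)) ha
  simp only [map_sum, map_smul, mfderiv_chartAt_frameVec hd] at h1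
  rw [frameVec_chart_symm hy] at h1
  have h2 := mfderiv_comp_apply (I := 𝓡 2) (I' := 𝓡 2) (I'' := 𝓡 2) y
    (mdifferentiableAt_chartAt hd) (mdifferentiableAt_chartAt_symm hy)
    (EuclideanSpace.single i (1 : ℝ))
  have h3 : fderiv ℝ (transition c d) y (EuclideanSpace.single i 1) =
      ∑ k, a k • (EuclideanSpace.single k (1 : ℝ) : 𝔼) := by
    rw [← mfderiv_eq_fderiv]
    exact h2.trans h1
  have h4 : ∀ k, fderiv ℝ (transition c d) y (EuclideanSpace.single i 1) k = a k := by
    intro k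
    rw [h3]
    fin_cases k <;> simp
  simp only [h4]
  exact ha

/-- The density `√D` transforms with the Jacobian of the transition map. -/
theorem coordDensity_transition {c d : M} {y : 𝔼} (hy : y ∈ (chartAt 𝔼 c).target)
    (hd : (chartAt 𝔼 c).symm y ∈ (chartAt 𝔼 d).source) :
    coordDensity g c y =
      |(fderiv ℝ (transition c d) y).det| * coordDensity g d (transition c d y) := by
  have h1 : ∀ i j, g.inner _ (frameVec d i ((chartAt 𝔼 c).symm y)) (frameVec d j _) =
      metricCoeff g d i j (transition c d y) := by
    intro i j
    have h := inner_frameVec g ((chartAt 𝔼 d).map_source hd) i j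
    rw [(chartAt 𝔼 d).left_inv hd] at h
    exact h
  have h2 : metricDet g c y = (fderiv ℝ (transition c d) y).det ^ 2 *
      metricDet g d (transition c d y) := by
    rw [metricDet, metricDet, ← inner_frameVec g hy, ← inner_frameVec g hy, ← inner_frameVec g hy,
      det_eq_apply_single, frameVec_eq_sum_frameVec hy hd, frameVec_eq_sum_frameVec hy hd]
    simp only [Fin.sum_univ_two, map_add, map_smul, add_apply, smul_apply, smul_eq_mul, h1,
      metricCoeff_symm g d 1 0]
    ring
  rw [coordDensity_eq, coordDensity_eq, h2, Real.sqrt_mul (sq_nonneg _), Real.sqrt_sq_eq_abs]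

section ChartPartition

variable [T2Space M] [CompactSpace M]

theorem finite_chartPartition_support :
    {d : M | (Function.support (chartPartition 2 M d)).Nonempty}.Finite :=
  (chartPartition 2 M).locallyFinite.finite_nonempty_of_compact

theorem sum_chartPartition (p : M) :
    ∑ d ∈ (finite_chartPartition_support (M := M)).toFinset, chartPartition 2 M d p = 1 := by
  rw [← (chartPartition 2 M).sum_eq_one (mem_univ p)]
  refine (finsum_eq_sum_of_support_subset _ fun d hd => ?_).symm
  simp only [Finite.coe_toFinset, mem_ofPred_eq]
  exact ⟨p, hd⟩

theorem chartPartition_eq_zero {d p : M} (hp : p ∉ (chartAt 𝔼 d).source) :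
    chartPartition 2 M d p = 0 := by
  by_contra h
  exact hp (chartPartition_isSubordinate 2 M d (subset_tsupport _ h))

end ChartPartition

variable [MeasurableSpace M] [BorelSpace M]

omit [IsManifold (𝓡 2) ∞ M] in
theorem measurableSet_target_inter_preimage (c : M) {A : Set M} (hA : MeasurableSet A) :
    MeasurableSet ((chartAt 𝔼 c).symm ⁻¹' A ∩ (chartAt 𝔼 c).target) := by
  have h1 : Measurable ((chartAt 𝔼 c).target.domRestrict (chartAt 𝔼 c).symm) :=
    ((chartAt 𝔼 c).continuousOn_symm.domRestrict).measurable
  have h2 := (chartAt 𝔼 c).open_target.measurableSet.subtype_image (h1 hA)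
  convert h2 using 1
  ext y
  simp [and_comm, Set.domRestrict]

theorem aemeasurable_chartAt_symm (c : M) :
    AEMeasurable (chartAt 𝔼 c).symm
      (((volume : Measure 𝔼).restrict (chartAt 𝔼 c).target).withDensity
        fun y => ENNReal.ofReal (coordDensity g c y)) :=
  ((chartAt 𝔼 c).continuousOn_symm.aemeasurable
    (chartAt 𝔼 c).open_target.measurableSet).mono_ac (withDensity_absolutelyContinuous _ _)

theorem chartVolume_apply (c : M) {A : Set M} (hA : MeasurableSet A) :
    chartVolume g c A = ∫⁻ y in (chartAt 𝔼 c).symm ⁻¹' A ∩ (chartAt 𝔼 c).target,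
      ENNReal.ofReal (coordDensity g c y) := by
  rw [chartVolume, Measure.map_apply_of_aemeasurable (aemeasurable_chartAt_symm g c) hA,
    withDensity_apply', Measure.restrict_restrict' (chartAt 𝔼 c).open_target.measurableSet]

/-- Two chart measures agree on the overlap of their chart domains. -/
theorem chartVolume_apply_of_subset {c d : M} {A : Set M} (hA : MeasurableSet A)
    (hc : A ⊆ (chartAt 𝔼 c).source) (hd : A ⊆ (chartAt 𝔼 d).source) :
    chartVolume g d A = chartVolume g c A := by
  rw [chartVolume_apply g c hA, chartVolume_apply g d hA]
  have himg : transition c d '' ((chartAt 𝔼 c).symm ⁻¹' A ∩ (chartAt 𝔼 c).target) =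
      (chartAt 𝔼 d).symm ⁻¹' A ∩ (chartAt 𝔼 d).target := by
    ext z
    constructor
    · rintro ⟨y, ⟨hy, hyt⟩, rfl⟩
      refine ⟨?_, (chartAt 𝔼 d).map_source (hd hy)⟩
      rw [mem_preimage, transition, (chartAt 𝔼 d).left_inv (hd hy)]
      exact hy
    · rintro ⟨hz, hzt⟩
      refine ⟨chartAt 𝔼 c ((chartAt 𝔼 d).symm z), ⟨?_, (chartAt 𝔼 c).map_source (hc hz)⟩, ?_⟩
      · rw [mem_preimage, (chartAt 𝔼 c).left_inv (hc hz)]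
        exact hz
      · rw [transition, (chartAt 𝔼 c).left_inv (hc hz), (chartAt 𝔼 d).right_inv hzt]
  have hinj : InjOn (transition c d) ((chartAt 𝔼 c).symm ⁻¹' A ∩ (chartAt 𝔼 c).target) := by
    rintro y ⟨hy, hyt⟩ z ⟨hz, hzt⟩ h
    exact (chartAt 𝔼 c).symm.injOn hyt hzt ((chartAt 𝔼 d).injOn (hd hy) (hd hz) h)
  have hm := measurableSet_target_inter_preimage c hA
  rw [← himg, lintegral_image_eq_lintegral_abs_det_fderiv_mul volume hm
    (f' := fderiv ℝ (transition c d)) (fun y hy => ?_) hinj]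
  · refine setLIntegral_congr_fun hm fun y hy => ?_
    rw [← ENNReal.ofReal_mul (abs_nonneg _), ← coordDensity_transition g hy.2 (hd hy.1)]
  · exact (mdifferentiableAt_iff_differentiableAt.1
      (mdifferentiableAt_transition hy.2 (hd hy.1))).hasFDerivAt.hasFDerivWithinAt

theorem chartVolume_restrict_source (c : M) :
    (chartVolume g c).restrict (chartAt 𝔼 c).source = chartVolume g c := by
  refine Measure.ext fun A hA => ?_
  have hS := (chartAt 𝔼 c).open_source.measurableSet
  rw [Measure.restrict_apply hA, chartVolume_apply g c (hA.inter hS), chartVolume_apply g c hA]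
  congr 2
  ext y
  simp only [mem_inter_iff, mem_preimage]
  exact ⟨fun h => ⟨h.1.1, h.2⟩, fun h => ⟨⟨h.1, (chartAt 𝔼 c).map_target h.2⟩, h.2⟩⟩

theorem chartVolume_restrict_source_inter (c d : M) :
    (chartVolume g d).restrict ((chartAt 𝔼 c).source ∩ (chartAt 𝔼 d).source) =
      (chartVolume g c).restrict ((chartAt 𝔼 c).source ∩ (chartAt 𝔼 d).source) := by
  have hS := (chartAt 𝔼 c).open_source.measurableSet.inter (chartAt 𝔼 d).open_source.measurableSet
  refine Measure.ext fun A hA => ?_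
  rw [Measure.restrict_apply hA, Measure.restrict_apply hA]
  exact chartVolume_apply_of_subset g (hA.inter hS) (fun x hx => hx.2.1) (fun x hx => hx.2.2)

variable [T2Space M] [CompactSpace M]

/-- On the domain of a chart the glued volume is the volume of the chart. -/
theorem vol_restrict_source (c : M) :
    (vol g).restrict (chartAt 𝔼 c).source = chartVolume g c := by
  have hSc := (chartAt 𝔼 c).open_source.measurableSet
  have hρ : ∀ d, Measurable fun p => ENNReal.ofReal (chartPartition 2 M d p) := fun d =>
    (chartPartition 2 M d).contMDiff.continuous.measurable.ennreal_ofReal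
  -- Each summand lives on the chart domain at `d`, and the two chart measures agree on the overlap.
  have key : ∀ d, (((chartVolume g d).withDensity
      fun p => ENNReal.ofReal (chartPartition 2 M d p)).restrict (chartAt 𝔼 c).source) =
      (chartVolume g c).withDensity fun p => ENNReal.ofReal (chartPartition 2 M d p) := by
    intro d
    have hSd := (chartAt 𝔼 d).open_source.measurableSet
    rw [restrict_withDensity hSc, ← chartVolume_restrict_source g d,
      Measure.restrict_restrict hSc, chartVolume_restrict_source_inter g c d, inter_comm,
      ← Measure.restrict_restrict hSd, chartVolume_restrict_source g c]
    refine Measure.ext fun A hA => ?_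
    rw [withDensity_apply _ hA, withDensity_apply _ hA, Measure.restrict_restrict hA,
      ← lintegral_indicator hA, ← lintegral_indicator (hA.inter hSd)]
    congr 1
    funext p
    by_cases hp : p ∈ (chartAt 𝔼 d).source
    · by_cases hpA : p ∈ A <;> simp [indicator, hp, hpA]
    · simp [indicator, hp, chartPartition_eq_zero hp]
  rw [vol, Measure.restrict_sum _ hSc]
  simp only [key]
  refine Measure.ext fun A hA => ?_
  rw [Measure.sum_apply _ hA,
    tsum_eq_sum (s := (finite_chartPartition_support (M := M)).toFinset) (fun d hd => ?_)]
  · simp only [withDensity_apply _ hA]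
    rw [← lintegral_finsetSum _ (fun d _ => hρ d)]
    simp only [← ENNReal.ofReal_sum_of_nonneg fun d _ => (chartPartition 2 M).nonneg d _,
      sum_chartPartition]
    simp
  · simp only [Finite.mem_toFinset, mem_ofPred_eq, not_nonempty_iff_eq_empty,
      Function.support_eq_empty_iff] at hd
    simp [hd]

theorem isFiniteMeasure_vol : IsFiniteMeasure (vol g) := by
  have : IsLocallyFiniteMeasure (vol g) := by
    refine ⟨fun p => ?_⟩
    have hp := mem_chart_target 𝔼 p
    obtain ⟨K, hK, hKU, hKc⟩ := local_compact_nhds ((chartAt 𝔼 p).open_target.mem_nhds hp)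
    obtain ⟨W, hWK, hWo, hpW⟩ := mem_nhds_iff.1 hK
    have hopen := (chartAt 𝔼 p).isOpen_inter_preimage hWo
    refine ⟨_, hopen.mem_nhds ⟨mem_chart_source 𝔼 p, hpW⟩, ?_⟩
    have h1 : vol g ((chartAt 𝔼 p).source ∩ chartAt 𝔼 p ⁻¹' W) =
        chartVolume g p ((chartAt 𝔼 p).source ∩ chartAt 𝔼 p ⁻¹' W) := by
      rw [← vol_restrict_source, Measure.restrict_apply hopen.measurableSet,
        inter_eq_left.2 inter_subset_left]
    rw [h1, chartVolume_apply g p hopen.measurableSet]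
    have hint : IntegrableOn (coordDensity g p) K :=
      ((contDiffOn_coordDensity g p).continuousOn.mono hKU).integrableOn_compact hKc
    refine lt_of_le_of_lt (lintegral_mono_set (t := K) ?_) hint.lintegral_lt_top
    rintro y ⟨⟨_, hy⟩, hyt⟩
    rw [mem_preimage, (chartAt 𝔼 p).right_inv hyt] at hy
    exact hWK hy
  infer_instance

theorem setIntegral_vol_source (c : M) {f : M → ℝ} (hf : Continuous f) :
    ∫ p in (chartAt 𝔼 c).source, f p ∂(vol g) =
      ∫ y in (chartAt 𝔼 c).target, coordDensity g c y * f ((chartAt 𝔼 c).symm y) := by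
  have hU := (chartAt 𝔼 c).open_target.measurableSet
  rw [vol_restrict_source, chartVolume, integral_map (aemeasurable_chartAt_symm g c)
    hf.aestronglyMeasurable, integral_withDensity_eq_integral_toReal_smul₀
    ((contDiffOn_coordDensity g c).continuousOn.aemeasurable hU).ennreal_ofReal (by simp)]
  refine setIntegral_congr_fun hU fun y hy => ?_
  simp [ENNReal.toReal_ofReal (coordDensity_pos g hy).le]

end VolumeMeasure

/-! ### Green's identity -/

section Green

variable {M : Type*} [TopologicalSpace M] [ChartedSpace 𝔼 M] [IsManifold (𝓡 2) ∞ M]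
  (g : SmoothMetric (𝓡 2) M)

theorem integral_pderiv_eq_zero {F : 𝔼 → ℝ} (hF : ContDiff ℝ 1 F) (hc : HasCompactSupport F)
    (i : Fin 2) : Integrable (pderiv i F) ∧ ∫ y, pderiv i F y = 0 := by
  have hcont : Continuous (pderiv i F) :=
    (hF.continuous_fderiv (by simp)).clm_apply continuous_const
  have hc' : HasCompactSupport (pderiv i F) := hc.fderiv_apply (𝕜 := ℝ) _
  have hint : Integrable (pderiv i F) := hcont.integrable_of_hasCompactSupport hc'
  refine ⟨hint, ?_⟩
  -- Integration by parts against the constant function `1`.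
  have h := integral_mul_fderiv_eq_neg_fderiv_mul_of_integrable (μ := (volume : Measure 𝔼))
    (f := F) (g := fun _ => (1 : ℝ)) (v := EuclideanSpace.single i (1 : ℝ))
    (by simp only [mul_one]; exact hint) (by simp)
    (by simpa using hF.continuous.integrable_of_hasCompactSupport hc)
    (fun x _ => hF.differentiable (by simp) x) (fun x _ => differentiableAt_const _)
  simpa [pderiv] using h

/-- Continuity is read off from the coordinate expression. -/
theorem continuous_laplace {w : M → ℝ} (hw : ContMDiff (𝓡 2) 𝓘(ℝ, ℝ) 2 w) :
    Continuous (laplace g w) := by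
  have h : ContMDiff (𝓡 2) 𝓘(ℝ, ℝ) (0 : ℕ) (laplace g w) := by
    rw [contMDiff_iff_contDiffOn_chart]
    intro c
    have hD := contDiffOn_coordDensity g c
    have ha := contDiffOn_coordGrad (k := 1) g (contMDiff_iff_contDiffOn_chart (k := 2).1 hw c)
    have h1 : ContDiffOn ℝ (0 : ℕ) (fun y => (∑ i, pderiv i (fun z => coordDensity g c z *
        coordGrad g c (fun z => w ((chartAt 𝔼 c).symm z)) i z) y) / coordDensity g c y)
        (chartAt 𝔼 c).target := by
      refine ContDiffOn.div (ContDiffOn.sum fun i _ => ?_) (hD.of_le (by simp))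
        fun y hy => (coordDensity_pos g hy).ne'
      exact contDiffOn_pderiv (chartAt 𝔼 c).open_target
        ((hD.of_le (by exact ENat.LEInfty.out)).mul (ha i)) i
    refine h1.congr fun y hy => ?_
    rw [← coordDensity_mul_laplace g hy hw, mul_div_cancel_left₀ _ (coordDensity_pos g hy).ne']
  exact h.continuous

theorem continuous_inner_grad_grad {f h : M → ℝ} (hf : ContMDiff (𝓡 2) 𝓘(ℝ, ℝ) 1 f)
    (hh : ContMDiff (𝓡 2) 𝓘(ℝ, ℝ) 1 h) :
    Continuous fun p => g.inner p (grad g f p) (grad g h p) :=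
  (contMDiff_inner_grad_grad (k := 0) g hf hh).continuous

theorem grad_eq_zero_of_notMem_tsupport {h : M → ℝ} {p : M} (hp : p ∉ tsupport h) :
    grad g h p = 0 := by
  have h0 := notMem_tsupport_iff_eventuallyEq.1 hp
  have h1 : ∀ X, mvfderiv (𝓡 2) h p X = 0 := by
    intro X
    change (mfderiv (𝓡 2) 𝓘(ℝ, ℝ) h p X : ℝ) = 0
    rw [h0.mfderiv_eq]
    exact congrArg (fun L : TangentSpace (𝓡 2) p →L[ℝ] ℝ => L X)
      (mfderiv_const (I := 𝓡 2) (I' := 𝓘(ℝ, ℝ)) (x := p) (c := (0 : ℝ)))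
  refine ext_inner g fun Z => ?_
  rw [inner_grad, h1]
  simp

theorem inner_grad_add {h₁ h₂ : M → ℝ} {p : M} (hh₁ : MDifferentiableAt (𝓡 2) 𝓘(ℝ, ℝ) h₁ p)
    (hh₂ : MDifferentiableAt (𝓡 2) 𝓘(ℝ, ℝ) h₂ p) (X : TangentSpace (𝓡 2) p) :
    g.inner p (grad g (fun q => h₁ q + h₂ q) p) X =
      g.inner p (grad g h₁ p) X + g.inner p (grad g h₂ p) X := by
  simp only [inner_grad, mvfderiv_fun_add hh₁ hh₂, add_apply]

theorem inner_grad_mul {h₁ h₂ : M → ℝ} {p : M} (hh₁ : MDifferentiableAt (𝓡 2) 𝓘(ℝ, ℝ) h₁ p)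
    (hh₂ : MDifferentiableAt (𝓡 2) 𝓘(ℝ, ℝ) h₂ p) (X : TangentSpace (𝓡 2) p) :
    g.inner p (grad g (fun q => h₁ q * h₂ q) p) X =
      h₁ p * g.inner p (grad g h₂ p) X + h₂ p * g.inner p (grad g h₁ p) X := by
  simp only [inner_grad, mvfderiv_fun_mul hh₁ hh₂, add_apply, smul_apply, smul_eq_mul]

variable [T2Space M] [CompactSpace M] [MeasurableSpace M] [BorelSpace M]

theorem integrable_vol_of_continuous {f : M → ℝ} (hf : Continuous f) :
    Integrable f (vol g) := by
  have := isFiniteMeasure_vol g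
  exact hf.integrable_of_hasCompactSupport (HasCompactSupport.of_compactSpace f)

/-- Green's identity for a test function supported in a chart domain, where it reduces to the
vanishing of `∫ ∂ᵢ (h √D gⁱʲ ∂ⱼw) dy`. -/
theorem integral_green_of_tsupport_subset {c : M} {h w : M → ℝ}
    (hh : ContMDiff (𝓡 2) 𝓘(ℝ, ℝ) 1 h) (hw : ContMDiff (𝓡 2) 𝓘(ℝ, ℝ) 2 w)
    (hs : tsupport h ⊆ (chartAt 𝔼 c).source) :
    ∫ p, (h p * laplace g w p + g.inner p (grad g h p) (grad g w p)) ∂(vol g) = 0 := by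
  have hw1 : ContMDiff (𝓡 2) 𝓘(ℝ, ℝ) 1 w := hw.of_le (by norm_num)
  have hcont : Continuous fun p => h p * laplace g w p + g.inner p (grad g h p) (grad g w p) :=
    (hh.continuous.mul (continuous_laplace g hw)).add (continuous_inner_grad_grad g hh hw1)
  have hzero : ∀ p, p ∉ (chartAt 𝔼 c).source →
      h p * laplace g w p + g.inner p (grad g h p) (grad g w p) = 0 := by
    intro p hp
    have hp' : p ∉ tsupport h := fun h' => hp (hs h')
    rw [image_eq_zero_of_notMem_tsupport hp', grad_eq_zero_of_notMem_tsupport g hp']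
    simp
  rw [← setIntegral_eq_integral_of_forall_compl_eq_zero hzero, setIntegral_vol_source g c hcont]
  set U := (chartAt 𝔼 c).target with hU
  have hUo : IsOpen U := (chartAt 𝔼 c).open_target
  set K := chartAt 𝔼 c '' tsupport h with hK
  have hKc : IsCompact K :=
    (isClosed_tsupport h).isCompact.image_of_continuousOn ((chartAt 𝔼 c).continuousOn.mono hs)
  have hKU : K ⊆ U := by
    rintro _ ⟨p, hp, rfl⟩
    exact (chartAt 𝔼 c).map_source (hs hp)
  set h' : 𝔼 → ℝ := fun z => h ((chartAt 𝔼 c).symm z) with hh'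
  set b : Fin 2 → 𝔼 → ℝ := fun i z => coordDensity g c z *
    coordGrad g c (fun z => w ((chartAt 𝔼 c).symm z)) i z with hb
  have hh'1 : ContDiffOn ℝ 1 h' U := contMDiff_iff_contDiffOn_chart (k := 1).1 hh c
  have hb1 : ∀ i, ContDiffOn ℝ 1 (b i) U := fun i =>
    ((contDiffOn_coordDensity g c).of_le (by exact ENat.LEInfty.out)).mul
      (contDiffOn_coordGrad (k := 1) g (contMDiff_iff_contDiffOn_chart (k := 2).1 hw c) i)
  -- Off `U` the inverse chart takes junk values, so the field is cut off there by hand; it is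
  -- still `C¹`, as it vanishes off the compact subset `K` of `U`.
  let F : Fin 2 → 𝔼 → ℝ := fun i => U.indicator fun y => h' y * b i y
  have hFK : ∀ i y, y ∉ K → F i y = 0 := by
    intro i y hy
    by_cases hyU : y ∈ U
    · have : h' y = 0 := by
        refine image_eq_zero_of_notMem_tsupport (f := h) fun hmem => hy ⟨_, hmem, ?_⟩
        exact (chartAt 𝔼 c).right_inv hyU
      simp [F, hyU, this]
    · simp [F, hyU]
  have hFnear : ∀ i y, y ∈ U → F i =ᶠ[nhds y] fun y => h' y * b i y := by
    intro i y hy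
    filter_upwards [hUo.mem_nhds hy] with z hz
    simp [F, hz]
  have hFfar : ∀ i y, y ∉ K → F i =ᶠ[nhds y] fun _ => 0 := by
    intro i y hy
    filter_upwards [hKc.isClosed.isOpen_compl.mem_nhds hy] with z hz
    exact hFK i z hz
  have hF1 : ∀ i, ContDiff ℝ 1 (F i) := by
    intro i
    rw [contDiff_iff_contDiffAt]
    intro y
    by_cases hy : y ∈ U
    · exact ((hh'1.mul (hb1 i)).contDiffAt (hUo.mem_nhds hy)).congr_of_eventuallyEq (hFnear i y hy)
    · exact contDiffAt_const.congr_of_eventuallyEq (hFfar i y fun h => hy (hKU h))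
  have hint := fun i =>
    integral_pderiv_eq_zero (hF1 i) (HasCompactSupport.intro hKc (hFK i)) i
  have hon : ∀ y ∈ U, coordDensity g c y * (h ((chartAt 𝔼 c).symm y) *
      laplace g w ((chartAt 𝔼 c).symm y) + g.inner ((chartAt 𝔼 c).symm y)
        (grad g h ((chartAt 𝔼 c).symm y)) (grad g w ((chartAt 𝔼 c).symm y))) =
      ∑ i, pderiv i (F i) y := by
    intro y hy
    have hpF : ∀ i, pderiv i (F i) y = h' y * pderiv i (b i) y + b i y * pderiv i h' y := by
      intro i
      have h1 := ((hh'1.contDiffAt (hUo.mem_nhds hy)).differentiableAt (by simp)).hasFDerivAt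
      have h2 := (((hb1 i).contDiffAt (hUo.mem_nhds hy)).differentiableAt (by simp)).hasFDerivAt
      rw [pderiv, (hFnear i y hy).fderiv_eq, (h1.fun_mul h2).fderiv]
      simp [pderiv]
    rw [mul_add, mul_left_comm, coordDensity_mul_laplace g hy hw,
      inner_grad_grad g hy (hh.mdifferentiableAt (by simp)) (hw.mdifferentiableAt (by simp))]
    simp only [hpF, Fin.sum_univ_two, hb, hh']
    ring
  rw [setIntegral_congr_fun hUo.measurableSet hon,
    setIntegral_eq_integral_of_forall_compl_eq_zero fun y hy => ?_,
    integral_finsetSum _ fun i _ => (hint i).1]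
  · simp [(hint _).2]
  · refine Finset.sum_eq_zero fun i _ => ?_
    rw [pderiv, (hFfar i y fun h => hy (hKU h)).fderiv_eq]
    simp

/-- Green's identity `∫ (h Δw + ⟨∇h, ∇w⟩) = 0` on a closed surface. -/
theorem integral_green {h w : M → ℝ} (hh : ContMDiff (𝓡 2) 𝓘(ℝ, ℝ) 1 h)
    (hw : ContMDiff (𝓡 2) 𝓘(ℝ, ℝ) 2 w) :
    ∫ p, (h p * laplace g w p + g.inner p (grad g h p) (grad g w p)) ∂(vol g) = 0 := by
  have hw1 : ContMDiff (𝓡 2) 𝓘(ℝ, ℝ) 1 w := hw.of_le (by norm_num)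
  have hint : ∀ h : M → ℝ, ContMDiff (𝓡 2) 𝓘(ℝ, ℝ) 1 h → Integrable
      (fun p => h p * laplace g w p + g.inner p (grad g h p) (grad g w p)) (vol g) := fun h hh =>
    integrable_vol_of_continuous g
      ((hh.continuous.mul (continuous_laplace g hw)).add (continuous_inner_grad_grad g hh hw1))
  have hρ : ∀ d, ContMDiff (𝓡 2) 𝓘(ℝ, ℝ) 1 (fun p => chartPartition 2 M d p * h p) := fun d =>
    ((chartPartition 2 M d).contMDiff.of_le (by exact ENat.LEInfty.out)).mul hh
  have key : ∀ T : Finset M, ContMDiff (𝓡 2) 𝓘(ℝ, ℝ) 1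
      (fun p => ∑ d ∈ T, chartPartition 2 M d p * h p) ∧
      ∫ p, ((∑ d ∈ T, chartPartition 2 M d p * h p) * laplace g w p + g.inner p
        (grad g (fun p => ∑ d ∈ T, chartPartition 2 M d p * h p) p) (grad g w p)) ∂(vol g) = 0 := by
    classical
    intro T
    induction T using Finset.induction_on with
    | empty =>
      refine ⟨by simpa using contMDiff_const, ?_⟩
      have : ∀ p, grad g (fun _ : M => (0 : ℝ)) p = 0 := fun p =>
        grad_eq_zero_of_notMem_tsupport g (by simp [tsupport])
      simp [this]
    | insert d T hd ih =>
      simp only [Finset.sum_insert hd]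
      refine ⟨(hρ d).add ih.1, ?_⟩
      have h1 := integral_green_of_tsupport_subset g (c := d) (hρ d) hw
        ((tsupport_mul_subset_left (f := fun p => chartPartition 2 M d p)).trans
          (chartPartition_isSubordinate 2 M d))
      rw [← add_zero (0 : ℝ)]
      nth_rewrite 1 [← h1]
      rw [← ih.2, ← integral_add (hint _ (hρ d)) (hint _ ih.1)]
      refine integral_congr_ae (Filter.Eventually.of_forall fun p => ?_)
      simp only [inner_grad_add g ((hρ d).mdifferentiableAt (x := p) (by simp))
        (ih.1.mdifferentiableAt (x := p) (by simp))]
      ring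
  have h1 := (key (finite_chartPartition_support (M := M)).toFinset).2
  simpa only [← Finset.sum_mul, sum_chartPartition, one_mul] using h1

end Green

/-! ### The energy identity at a fixed time -/

section StressEnergy

variable {M : Type*} [TopologicalSpace M] [ChartedSpace 𝔼 M] [IsManifold (𝓡 2) ∞ M]
  (g : SmoothMetric (𝓡 2) M)

theorem inner_hess_grad_eq_half {w : M → ℝ} (hw : ContMDiff (𝓡 2) 𝓘(ℝ, ℝ) 2 w) (p : M)
    (X : TangentSpace (𝓡 2) p) :
    g.inner p (hess g w p X) (grad g w p) =
      g.inner p (grad g (fun q => g.inner q (grad g w q) (grad g w q)) p) X / 2 := by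
  rw [inner_grad, mvfderiv_inner_grad_grad g hw hw, g.symm p (grad g w p)]
  ring

/-- `Hess η (∇w, ∇w)` expressed through gradients of functions only. -/
theorem inner_hess_grad_grad {η w : M → ℝ} (hη : ContMDiff (𝓡 2) 𝓘(ℝ, ℝ) 2 η)
    (hw : ContMDiff (𝓡 2) 𝓘(ℝ, ℝ) 2 w) (p : M) :
    g.inner p (hess g η p (grad g w p)) (grad g w p) =
      g.inner p (grad g (fun q => g.inner q (grad g η q) (grad g w q)) p) (grad g w p) -
      g.inner p (grad g (fun q => g.inner q (grad g w q) (grad g w q)) p) (grad g η p) / 2 := by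
  have h1 := mvfderiv_inner_grad_grad g hη hw p (grad g w p)
  rw [← inner_grad g, g.symm p (grad g η p), inner_hess_comm g hw, inner_hess_grad_eq_half g hw]
    at h1
  linarith

theorem continuous_inner_hess_grad {η w : M → ℝ} (hη : ContMDiff (𝓡 2) 𝓘(ℝ, ℝ) 2 η)
    (hw : ContMDiff (𝓡 2) 𝓘(ℝ, ℝ) 2 w) :
    Continuous fun p => g.inner p (hess g η p (grad g w p)) (grad g w p) := by
  simp only [inner_hess_grad_grad g hη hw]
  have h1 := contMDiff_inner_grad_grad (k := 1) g hη hw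
  have h2 := contMDiff_inner_grad_grad (k := 1) g hw hw
  exact (continuous_inner_grad_grad g h1 (hw.of_le (by norm_num))).sub
    ((continuous_inner_grad_grad g h2 (hη.of_le (by norm_num))).div_const 2)

/-- The Ginzburg-Landau energy density of the map with components `w i`. -/
def scalarEnergy (ε : ℝ) (w : Fin 2 → M → ℝ) (p : M) : ℝ :=
  (∑ i, g.inner p (grad g (w i) p) (grad g (w i) p)) / 2 +
    (1 - ∑ i, w i p ^ 2) ^ 2 / (4 * ε ^ 2)

theorem contMDiff_scalarEnergy (ε : ℝ) {w : Fin 2 → M → ℝ}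
    (hw : ∀ i, ContMDiff (𝓡 2) 𝓘(ℝ, ℝ) 2 (w i)) :
    ContMDiff (𝓡 2) 𝓘(ℝ, ℝ) 1 (scalarEnergy g ε w) := by
  refine (contMDiff_iff_contDiffOn_chart (k := 1)).2 fun c => ?_
  have h1 := fun i => (contMDiff_iff_contDiffOn_chart (k := 1)).1
    (contMDiff_inner_grad_grad (k := 1) g (hw i) (hw i)) c
  have h2 := fun i => (contMDiff_iff_contDiffOn_chart (k := 1)).1
    (ContMDiff.of_le (m := 1) (hw i) (by norm_num)) c
  exact ((ContDiffOn.sum fun i _ => h1 i).div_const 2).add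
    (((contDiffOn_const.sub (ContDiffOn.sum fun i _ => (h2 i).pow 2)).pow 2).div_const _)

/-- The differential of the energy density: `de = ∑ᵢ (Hess vᵢ (·, ∇vᵢ) - ε⁻² (1 - |v|²) vᵢ dvᵢ)`. -/
theorem inner_grad_scalarEnergy {ε : ℝ} {w : Fin 2 → M → ℝ}
    (hw : ∀ i, ContMDiff (𝓡 2) 𝓘(ℝ, ℝ) 2 (w i)) (p : M) (X : TangentSpace (𝓡 2) p) :
    g.inner p (grad g (scalarEnergy g ε w) p) X =
      ∑ i, (g.inner p (hess g (w i) p X) (grad g (w i) p)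
        - (1 - ∑ j, w j p ^ 2) / ε ^ 2 * w i p * g.inner p (grad g (w i) p) X) := by
  have h1 := fun i => (contMDiff_inner_grad_grad (k := 1) g (hw i) (hw i)).mdifferentiableAt
    (x := p) (by simp)
  have h2 := fun i => (hw i).mdifferentiableAt (x := p) (by simp)
  have hc : ∀ a : ℝ, MDifferentiableAt (𝓡 2) 𝓘(ℝ, ℝ) (fun _ : M => a) p := fun a =>
    mdifferentiableAt_const
  have hsq : ∀ i, MDifferentiableAt (𝓡 2) 𝓘(ℝ, ℝ) (w i * w i) p := fun i => (h2 i).mul (h2 i)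
  have hs := (hc 1).sub ((hsq 0).add (hsq 1))
  set Q : Fin 2 → M → ℝ := fun i q => g.inner q (grad g (w i) q) (grad g (w i) q) with hQ
  have he : scalarEnergy g ε w = (fun _ => 1 / 2) * (Q 0 + Q 1) + (fun _ => 1 / (4 * ε ^ 2)) *
      (((fun _ => 1) - (w 0 * w 0 + w 1 * w 1)) * ((fun _ => 1) - (w 0 * w 0 + w 1 * w 1))) := by
    funext q
    simp only [scalarEnergy, Fin.sum_univ_two, hQ, Pi.add_apply, Pi.mul_apply, Pi.sub_apply]
    ring
  rw [inner_grad, he, mvfderiv_add ((hc _).mul ((h1 0).add (h1 1))) ((hc _).mul (hs.mul hs)),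
    mvfderiv_mul (hc _) ((h1 0).add (h1 1)), mvfderiv_add (h1 0) (h1 1),
    mvfderiv_mul (hc _) (hs.mul hs), mvfderiv_mul hs hs,
    mvfderiv_sub (hc 1) ((hsq 0).add (hsq 1)), mvfderiv_add (hsq 0) (hsq 1),
    mvfderiv_mul (h2 0) (h2 0), mvfderiv_mul (h2 1) (h2 1)]
  simp only [mvfderiv_const, Fin.sum_univ_two, add_apply, smul_apply, sub_apply, smul_eq_mul,
    inner_hess_grad_eq_half g (hw _), ← inner_grad g, zero_apply, Pi.add_apply, Pi.mul_apply,
    Pi.sub_apply]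
  ring

/-- Terms with vanishing integral drop out of the energy balance. -/
theorem integral_combination {X : Type*} [MeasurableSpace X] {μ : Measure X} {L : ℝ}
    {H D C : X → ℝ} {A B : Fin 2 → X → ℝ} (hH : Integrable H μ) (hD : Integrable D μ)
    (hA : ∀ i, Integrable (A i) μ) (hB : ∀ i, Integrable (B i) μ) (hC : Integrable C μ)
    (hA0 : ∀ i, ∫ p, A i p ∂μ = 0) (hB0 : ∀ i, ∫ p, B i p ∂μ = 0) (hC0 : ∫ p, C p ∂μ = 0) :
    ∫ p, (L * H p - 1 / L * D p + (∑ i, A i p - L * (∑ i, B i p - C p))) ∂μ =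
      L * ∫ p, H p ∂μ - 1 / L * ∫ p, D p ∂μ := by
  have h1 : Integrable (fun p => L * H p - 1 / L * D p) μ :=
    (hH.const_mul L).sub (hD.const_mul _)
  have h2 : Integrable (fun p => ∑ i, A i p) μ := integrable_finsetSum _ fun i _ => hA i
  have h3 : Integrable (fun p => ∑ i, B i p) μ := integrable_finsetSum _ fun i _ => hB i
  have h4 : Integrable (fun p => L * (∑ i, B i p - C p)) μ := (h3.sub hC).const_mul L
  have h5 : Integrable (fun p => ∑ i, A i p - L * (∑ i, B i p - C p)) μ := h2.sub h4
  rw [integral_add h1 h5, integral_sub (hH.const_mul L) (hD.const_mul _),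
    integral_const_mul, integral_const_mul, integral_sub h2 h4, integral_const_mul,
    integral_sub h3 hC, integral_finsetSum _ fun i _ => hA i, integral_finsetSum _ fun i _ => hB i]
  simp [hA0, hB0, hC0]

variable [T2Space M] [CompactSpace M] [MeasurableSpace M] [BorelSpace M]

/-- The energy identity at a fixed time: `w` is the map, `w'` its time derivative, linked by the
flow equation `w' / L = Δw + ε⁻² (1 - |w|²) w`. It combines Green's identity for the pairs
`(η w'ᵢ, wᵢ)`, `(⟨∇η, ∇wᵢ⟩, wᵢ)` and `(e, η)`. -/
theorem integral_energy_derivative {ε L : ℝ} (hL : L ≠ 0) {η : M → ℝ} {w w' : Fin 2 → M → ℝ}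
    (hη : ContMDiff (𝓡 2) 𝓘(ℝ, ℝ) 2 η) (hw : ∀ i, ContMDiff (𝓡 2) 𝓘(ℝ, ℝ) 2 (w i))
    (hw' : ∀ i, ContMDiff (𝓡 2) 𝓘(ℝ, ℝ) 1 (w' i))
    (heq : ∀ i p, 1 / L * w' i p - laplace g (w i) p = (1 - ∑ j, w j p ^ 2) / ε ^ 2 * w i p) :
    ∫ p, η p * ∑ i, (g.inner p (grad g (w i) p) (grad g (w' i) p)
        - (1 - ∑ j, w j p ^ 2) / ε ^ 2 * w i p * w' i p) ∂(vol g) =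
      L * ∫ p, ((∑ i, g.inner p (hess g η p (grad g (w i) p)) (grad g (w i) p))
          - laplace g η p * scalarEnergy g ε w p) ∂(vol g)
        - 1 / L * ∫ p, η p * ∑ i, w' i p ^ 2 ∂(vol g) := by
  have hη1 : ContMDiff (𝓡 2) 𝓘(ℝ, ℝ) 1 η := hη.of_le (by norm_num)
  have he := contMDiff_scalarEnergy g ε hw
  have hq := fun i => contMDiff_inner_grad_grad (k := 1) g hη (hw i)
  have hηw' := fun i => hη1.mul (hw' i)
  have hcont : ∀ {h w : M → ℝ}, ContMDiff (𝓡 2) 𝓘(ℝ, ℝ) 1 h → ContMDiff (𝓡 2) 𝓘(ℝ, ℝ) 2 w →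
      Integrable (fun p => h p * laplace g w p + g.inner p (grad g h p) (grad g w p)) (vol g) :=
    fun hh hw => integrable_vol_of_continuous g ((hh.continuous.mul (continuous_laplace g hw)).add
      (continuous_inner_grad_grad g hh (hw.of_le (by norm_num))))
  have hi1 := fun i => hcont (hηw' i) (hw i)
  have hi2 := fun i => hcont (hq i) (hw i)
  have hi3 := hcont he hη
  have hA1 := fun i => integral_green g (hηw' i) (hw i)
  have hA2 := fun i => integral_green g (hq i) (hw i)
  have hA3 := integral_green g he hη
  have hiH : Integrable (fun p => (∑ i, g.inner p (hess g η p (grad g (w i) p)) (grad g (w i) p))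
      - laplace g η p * scalarEnergy g ε w p) (vol g) :=
    integrable_vol_of_continuous g
      ((continuous_finsetSum _ fun i _ => continuous_inner_hess_grad g hη (hw i)).sub
        ((continuous_laplace g hη).mul he.continuous))
  have hiD : Integrable (fun p => η p * ∑ i, w' i p ^ 2) (vol g) :=
    integrable_vol_of_continuous g
      (hη.continuous.mul (continuous_finsetSum _ fun i _ => (hw' i).continuous.pow 2))
  have key : ∀ p, η p * ∑ i, (g.inner p (grad g (w i) p) (grad g (w' i) p)
        - (1 - ∑ j, w j p ^ 2) / ε ^ 2 * w i p * w' i p) =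
      (L * ((∑ i, g.inner p (hess g η p (grad g (w i) p)) (grad g (w i) p))
          - laplace g η p * scalarEnergy g ε w p) - 1 / L * (η p * ∑ i, w' i p ^ 2)) +
      (∑ i, ((η p * w' i p) * laplace g (w i) p +
        g.inner p (grad g (fun q => η q * w' i q) p) (grad g (w i) p)) -
      L * (∑ i, (g.inner p (grad g η p) (grad g (w i) p) * laplace g (w i) p +
        g.inner p (grad g (fun q => g.inner q (grad g η q) (grad g (w i) q)) p) (grad g (w i) p)) -
      (scalarEnergy g ε w p * laplace g η p +
        g.inner p (grad g (scalarEnergy g ε w) p) (grad g η p)))) := by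
    intro p
    have h1 : ∀ i, g.inner p (grad g (fun q => g.inner q (grad g η q) (grad g (w i) q)) p)
        (grad g (w i) p) = g.inner p (hess g η p (grad g (w i) p)) (grad g (w i) p) +
          g.inner p (hess g (w i) p (grad g η p)) (grad g (w i) p) := by
      intro i
      rw [inner_grad, mvfderiv_inner_grad_grad g hη (hw i), g.symm p (grad g η p),
        inner_hess_comm g (hw i)]
    have h2 : ∀ i, laplace g (w i) p =
        1 / L * w' i p - (1 - ∑ j, w j p ^ 2) / ε ^ 2 * w i p := fun i => by
      rw [← heq i p]; ring
    simp only [h1, inner_grad_scalarEnergy g hw, h2,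
      fun i => inner_grad_mul g (hη1.mdifferentiableAt (x := p) (by simp))
        ((hw' i).mdifferentiableAt (x := p) (by simp)),
      fun i => g.symm p (grad g (w i) p) (grad g (w' i) p),
      fun i => g.symm p (grad g (w i) p) (grad g η p)]
    generalize (1 - ∑ j, w j p ^ 2) / ε ^ 2 = κ
    simp only [Fin.sum_univ_two]
    field_simp
    ring
  exact (integral_congr_ae (Filter.Eventually.of_forall key)).trans
    (integral_combination hiH hiD hi1 hi2 hi3 hA1 hA2 hA3)

end StressEnergy

/-! ### Time-dependent functions -/

section TimeDependent

variable {M : Type*} [TopologicalSpace M] [ChartedSpace 𝔼 M]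

/-- A time-dependent function is jointly `C^k` on `(0, ∞) × M`, expressed in the charts of `M`. -/
def TimeContDiff (k : ℕ) (f : ℝ → M → ℝ) : Prop :=
  ∀ c : M, ContDiffOn ℝ k (fun q : ℝ × 𝔼 => f q.1 ((chartAt 𝔼 c).symm q.2))
    (Ioi 0 ×ˢ (chartAt 𝔼 c).target)

theorem isOpen_Ioi_prod_target (c : M) : IsOpen (Ioi (0 : ℝ) ×ˢ (chartAt 𝔼 c).target) :=
  isOpen_Ioi.prod (chartAt 𝔼 c).open_target

theorem TimeContDiff.continuousOn {f : ℝ → M → ℝ} (hf : TimeContDiff 0 f) :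
    ContinuousOn (fun q : ℝ × M => f q.1 q.2) (Ioi 0 ×ˢ univ) := by
  rintro ⟨s, p⟩ ⟨hs, _⟩
  have h1 : ContinuousAt (fun q : ℝ × 𝔼 => f q.1 ((chartAt 𝔼 p).symm q.2)) (s, chartAt 𝔼 p p) :=
    (hf p).continuousOn.continuousAt
      ((isOpen_Ioi_prod_target p).mem_nhds ⟨hs, mem_chart_target 𝔼 p⟩)
  have h2 : ContinuousAt (fun q : ℝ × M => (q.1, chartAt 𝔼 p q.2)) (s, p) :=
    continuousAt_fst.prodMk (((chartAt 𝔼 p).continuousAt (mem_chart_source 𝔼 p)).comp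
      continuousAt_snd)
  have h3 : ContinuousAt ((fun q : ℝ × 𝔼 => f q.1 ((chartAt 𝔼 p).symm q.2)) ∘
    fun q : ℝ × M => (q.1, chartAt 𝔼 p q.2)) (s, p) := ContinuousAt.comp h1 h2
  refine (h3.congr ?_).continuousWithinAt
  filter_upwards [continuousAt_snd.preimage_mem_nhds
    ((chartAt 𝔼 p).open_source.mem_nhds (mem_chart_source 𝔼 p))] with q hq
  simp [(chartAt 𝔼 p).left_inv hq]

theorem TimeContDiff.of_le {k l : ℕ} {f : ℝ → M → ℝ} (hf : TimeContDiff k f) (h : l ≤ k) :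
    TimeContDiff l f := fun c => (hf c).of_le (by exact_mod_cast h)

theorem TimeContDiff.hasFDerivAt {k : ℕ} (hk : k ≠ 0) {f : ℝ → M → ℝ} (hf : TimeContDiff k f)
    {c : M} {s : ℝ} (hs : 0 < s) {y : 𝔼} (hy : y ∈ (chartAt 𝔼 c).target) :
    HasFDerivAt (fun q : ℝ × 𝔼 => f q.1 ((chartAt 𝔼 c).symm q.2))
      (fderiv ℝ (fun q : ℝ × 𝔼 => f q.1 ((chartAt 𝔼 c).symm q.2)) (s, y)) (s, y) :=
  (((hf c).contDiffAt ((isOpen_Ioi_prod_target c).mem_nhds (mk_mem_prod hs hy))).differentiableAt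
    (by exact_mod_cast hk)).hasFDerivAt

theorem TimeContDiff.hasDerivAt_chart {k : ℕ} (hk : k ≠ 0) {f : ℝ → M → ℝ}
    (hf : TimeContDiff k f) {c : M} {s : ℝ} (hs : 0 < s) {y : 𝔼}
    (hy : y ∈ (chartAt 𝔼 c).target) :
    HasDerivAt (fun r => f r ((chartAt 𝔼 c).symm y))
      (fderiv ℝ (fun q : ℝ × 𝔼 => f q.1 ((chartAt 𝔼 c).symm q.2)) (s, y) (1, 0)) s :=
  HasFDerivAt.comp_hasDerivAt (f := fun r : ℝ => (r, y)) s (hf.hasFDerivAt hk hs hy)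
    ((hasDerivAt_id s).prodMk (hasDerivAt_const s y))

theorem TimeContDiff.hasDerivAt {k : ℕ} (hk : k ≠ 0) {f : ℝ → M → ℝ} (hf : TimeContDiff k f)
    {s : ℝ} (hs : 0 < s) (p : M) :
    HasDerivAt (fun r => f r p) (deriv (fun r => f r p) s) s := by
  have h := hf.hasDerivAt_chart hk hs (mem_chart_target 𝔼 p)
  simp only [(chartAt 𝔼 p).left_inv (mem_chart_source 𝔼 p)] at h
  exact h.differentiableAt.hasDerivAt

theorem TimeContDiff.timeDeriv {k : ℕ} {f : ℝ → M → ℝ} (hf : TimeContDiff (k + 1) f) :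
    TimeContDiff k fun s p => deriv (fun r => f r p) s := by
  intro c
  have h := ((hf c).fderiv_of_isOpen (isOpen_Ioi_prod_target c) (m := k) (by norm_cast)).clm_apply
    (contDiffOn_const (c := ((1, 0) : ℝ × 𝔼)))
  refine h.congr ?_
  rintro ⟨s, y⟩ ⟨hs, hy⟩
  exact (hf.hasDerivAt_chart (by simp) hs hy).deriv

theorem TimeContDiff.pderiv_eq {k : ℕ} (hk : k ≠ 0) {f : ℝ → M → ℝ} (hf : TimeContDiff k f)
    {c : M} {s : ℝ} (hs : 0 < s) {y : 𝔼} (hy : y ∈ (chartAt 𝔼 c).target) (i : Fin 2) :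
    pderiv i (fun z => f s ((chartAt 𝔼 c).symm z)) y =
      fderiv ℝ (fun q : ℝ × 𝔼 => f q.1 ((chartAt 𝔼 c).symm q.2)) (s, y)
        (0, EuclideanSpace.single i (1 : ℝ)) := by
  have h := HasFDerivAt.comp (f := fun z : 𝔼 => (s, z)) y (hf.hasFDerivAt hk hs hy)
    ((hasFDerivAt_const s y).prodMk (hasFDerivAt_id y))
  rw [pderiv]
  have h2 := h.fderiv
  simp only [Function.comp_def] at h2
  rw [h2]
  simp

/-- Spatial derivatives of a jointly `C^(k+1)` function are jointly `C^k`. -/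
theorem TimeContDiff.contDiffOn_pderiv {k : ℕ} {f : ℝ → M → ℝ} (hf : TimeContDiff (k + 1) f) (c : M)
    (i : Fin 2) : ContDiffOn ℝ k
      (fun q : ℝ × 𝔼 => pderiv i (fun z => f q.1 ((chartAt 𝔼 c).symm z)) q.2)
      (Ioi 0 ×ˢ (chartAt 𝔼 c).target) := by
  have h := ((hf c).fderiv_of_isOpen (isOpen_Ioi_prod_target c) (m := k) (by norm_cast)).clm_apply
    (contDiffOn_const (c := ((0, EuclideanSpace.single i (1 : ℝ)) : ℝ × 𝔼)))
  refine h.congr ?_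
  rintro ⟨s, y⟩ ⟨hs, hy⟩
  exact hf.pderiv_eq (by simp) hs hy i

/-- Time and space derivatives of a jointly `C²` function commute. -/
theorem TimeContDiff.hasDerivAt_pderiv {f : ℝ → M → ℝ} (hf : TimeContDiff 2 f)
    {c : M} {s : ℝ} (hs : 0 < s) {y : 𝔼} (hy : y ∈ (chartAt 𝔼 c).target) (i : Fin 2) :
    HasDerivAt (fun r => pderiv i (fun z => f r ((chartAt 𝔼 c).symm z)) y)
      (pderiv i (fun z => deriv (fun r => f r ((chartAt 𝔼 c).symm z)) s) y) s := by
  set F := fun q : ℝ × 𝔼 => f q.1 ((chartAt 𝔼 c).symm q.2) with hF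
  have hFc : ContDiffAt ℝ 2 F (s, y) :=
    (hf c).contDiffAt ((isOpen_Ioi_prod_target c).mem_nhds ⟨hs, hy⟩)
  have h1 : HasFDerivAt (fderiv ℝ F) (fderiv ℝ (fderiv ℝ F) (s, y)) (s, y) :=
    ((hFc.fderiv_right (m := 1) (by norm_num)).differentiableAt (by simp)).hasFDerivAt
  have h2 := (hFc.isSymmSndFDerivAt (by simp)).eq (1, 0) (0, EuclideanSpace.single i (1 : ℝ))
  have h3 : HasDerivAt (fun r => fderiv ℝ F (r, y) (0, EuclideanSpace.single i (1 : ℝ)))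
      (fderiv ℝ (fderiv ℝ F) (s, y) (1, 0) (0, EuclideanSpace.single i (1 : ℝ))) s := by
    have h4 := HasFDerivAt.comp_hasDerivAt (f := fun r : ℝ => (r, y)) s h1
      ((hasDerivAt_id s).prodMk (hasDerivAt_const s y))
    simpa using h4.clm_apply (hasDerivAt_const s ((0, EuclideanSpace.single i (1 : ℝ)) : ℝ × 𝔼))
  have h5 : pderiv i (fun z => deriv (fun r => f r ((chartAt 𝔼 c).symm z)) s) y =
      fderiv ℝ (fderiv ℝ F) (s, y) (0, EuclideanSpace.single i (1 : ℝ)) (1, 0) := by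
    have h6 : (fun z => deriv (fun r => f r ((chartAt 𝔼 c).symm z)) s) =ᶠ[nhds y]
        fun z => fderiv ℝ F (s, z) (1, 0) := by
      filter_upwards [(chartAt 𝔼 c).open_target.mem_nhds hy] with z hz
      exact (hf.hasDerivAt_chart (by simp) hs hz).deriv
    have h7 := HasFDerivAt.comp (f := fun z : 𝔼 => (s, z)) y h1
      ((hasFDerivAt_const s y).prodMk (hasFDerivAt_id y))
    have h8 := (h7.clm_apply (hasFDerivAt_const ((1, 0) : ℝ × 𝔼) y)).fderiv
    simp only [Function.comp_def] at h8
    rw [pderiv, h6.fderiv_eq, h8]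
    simp
  rw [h5, ← h2]
  refine h3.congr_of_eventuallyEq ?_
  filter_upwards [Ioi_mem_nhds hs] with r hr
  exact hf.pderiv_eq (by simp) hr hy i

theorem deriv_apply_of_timeContDiff {v : ℝ → M → 𝔼} (hv : ∀ i, TimeContDiff 2 fun s p => v s p i)
    {s : ℝ} (hs : 0 < s) (p : M) (i : Fin 2) :
    deriv (fun r => v r p) s i = deriv (fun r => v r p i) s := by
  have h : DifferentiableAt ℝ (fun r => v r p) s :=
    differentiableAt_euclidean.2 fun i => ((hv i).hasDerivAt (by simp) hs p).differentiableAt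
  exact ((EuclideanSpace.proj (𝕜 := ℝ) i).hasFDerivAt.comp_hasDerivAt s h.hasDerivAt).deriv.symm

variable [IsManifold (𝓡 2) ∞ M] (g : SmoothMetric (𝓡 2) M)

theorem TimeContDiff.contMDiff {k : ℕ} {f : ℝ → M → ℝ} (hf : TimeContDiff k f) {s : ℝ}
    (hs : 0 < s) : ContMDiff (𝓡 2) 𝓘(ℝ, ℝ) k (f s) := by
  rw [contMDiff_iff_contDiffOn_chart]
  intro c
  exact (hf c).comp (contDiffOn_const.prodMk contDiffOn_id) fun y hy => ⟨hs, hy⟩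

theorem TimeContDiff.inner_grad_grad {k : ℕ} {f h : ℝ → M → ℝ} (hf : TimeContDiff (k + 1) f)
    (hh : TimeContDiff (k + 1) h) :
    TimeContDiff k fun s p => g.inner p (grad g (f s) p) (grad g (h s) p) := by
  intro c
  have hk : (k : ℕ∞ω) ≤ ∞ := by exact ENat.LEInfty.out
  have hmaps : MapsTo Prod.snd (Ioi (0 : ℝ) ×ˢ (chartAt 𝔼 c).target) (chartAt 𝔼 c).target :=
    fun q hq => hq.2
  have hG : ∀ i j, ContDiffOn ℝ k (fun q : ℝ × 𝔼 => metricCoeff g c i j q.2)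
      (Ioi 0 ×ˢ (chartAt 𝔼 c).target) := fun i j =>
    ((contDiffOn_metricCoeff g c i j).of_le hk).comp contDiffOn_snd hmaps
  have hD : ContDiffOn ℝ k (fun q : ℝ × 𝔼 => metricDet g c q.2)
      (Ioi 0 ×ˢ (chartAt 𝔼 c).target) :=
    ((contDiffOn_metricDet g c).of_le hk).comp contDiffOn_snd hmaps
  have hD0 : ∀ q ∈ Ioi (0 : ℝ) ×ˢ (chartAt 𝔼 c).target, metricDet g c q.2 ≠ 0 := fun q hq =>
    (metricDet_pos g hq.2).ne'
  have hF := hf.contDiffOn_pderiv c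
  have hH := hh.contDiffOn_pderiv c
  have ha : ∀ i, ContDiffOn ℝ k (fun q : ℝ × 𝔼 =>
      coordGrad g c (fun z => h q.1 ((chartAt 𝔼 c).symm z)) i q.2)
      (Ioi 0 ×ˢ (chartAt 𝔼 c).target) := by
    intro i
    fin_cases i
    · exact (((hG 1 1).mul (hH 0)).sub ((hG 0 1).mul (hH 1))).div hD hD0
    · exact (((hG 0 0).mul (hH 1)).sub ((hG 0 1).mul (hH 0))).div hD hD0
  refine (ContDiffOn.sum (s := Finset.univ) fun i _ => (ha i).mul (hF i)).congr ?_
  rintro ⟨s, y⟩ ⟨hs, hy⟩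
  exact Riem.inner_grad_grad g hy ((hf.contMDiff hs).mdifferentiableAt (by simp))
    ((hh.contMDiff hs).mdifferentiableAt (by simp))

/-- In a fixed chart only the partial derivatives of `f` depend on time, and they enter
`gⁱʲ ∂ᵢf ∂ⱼf` quadratically. -/
theorem TimeContDiff.hasDerivAt_inner_grad_grad {f : ℝ → M → ℝ} (hf : TimeContDiff 2 f)
    {s : ℝ} (hs : 0 < s) (p : M) :
    HasDerivAt (fun r => g.inner p (grad g (f r) p) (grad g (f r) p))
      (2 * g.inner p (grad g (f s) p) (grad g (fun q => deriv (fun r => f r q) s) p)) s := by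
  have key : ∀ (c : M) (y : 𝔼), y ∈ (chartAt 𝔼 c).target →
      HasDerivAt (fun r => g.inner ((chartAt 𝔼 c).symm y) (grad g (f r) _) (grad g (f r) _))
      (2 * g.inner ((chartAt 𝔼 c).symm y) (grad g (f s) _)
        (grad g (fun q => deriv (fun r => f r q) s) _)) s := by
    intro c y hy
    have hp := fun i => hf.hasDerivAt_pderiv hs hy i
    have hmd : ∀ r, 0 < r → MDifferentiableAt (𝓡 2) 𝓘(ℝ, ℝ) (f r) ((chartAt 𝔼 c).symm y) :=
      fun r hr => (hf.contMDiff hr).mdifferentiableAt (by simp)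
    have hmd' : MDifferentiableAt (𝓡 2) 𝓘(ℝ, ℝ) (fun q => deriv (fun r => f r q) s)
      ((chartAt 𝔼 c).symm y) :=
      ((TimeContDiff.timeDeriv (k := 1) hf).contMDiff hs).mdifferentiableAt (by simp)
    have h1 : (fun r => g.inner ((chartAt 𝔼 c).symm y) (grad g (f r) _) (grad g (f r) _))
        =ᶠ[nhds s] fun r => ∑ i, coordGrad g c (fun z => f r ((chartAt 𝔼 c).symm z)) i y *
          pderiv i (fun z => f r ((chartAt 𝔼 c).symm z)) y := by
      filter_upwards [Ioi_mem_nhds hs] with r hr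
      exact Riem.inner_grad_grad g hy (hmd r hr) (hmd r hr)
    rw [Riem.inner_grad_grad g hy (hmd s hs) hmd']
    refine HasDerivAt.congr_of_eventuallyEq ?_ h1
    simp only [Fin.sum_univ_two, coordGrad, Matrix.cons_val_zero, Matrix.cons_val_one]
    have h2 := ((((((hp 0).const_mul (metricCoeff g c 1 1 y)).sub
      ((hp 1).const_mul (metricCoeff g c 0 1 y))).div_const (metricDet g c y)).mul (hp 0)).add
      (((((hp 1).const_mul (metricCoeff g c 0 0 y)).sub
      ((hp 0).const_mul (metricCoeff g c 0 1 y))).div_const (metricDet g c y)).mul (hp 1)))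
    refine h2.congr_deriv ?_
    simp only [Pi.sub_apply]
    ring
  have h := key p _ (mem_chart_target 𝔼 p)
  rw [(chartAt 𝔼 p).left_inv (mem_chart_source 𝔼 p)] at h
  exact h

/-- The components of a map jointly `C²` on `(0, ∞) × M` are jointly `C²` in charts. -/
theorem timeContDiff_component {v : ℝ → M → 𝔼}
    (hv : ContMDiffOn (𝓘(ℝ, ℝ).prod (𝓡 2)) 𝓘(ℝ, 𝔼) 2 (fun q : ℝ × M => v q.1 q.2)
      (Ioi 0 ×ˢ univ)) (i : Fin 2) : TimeContDiff 2 fun s p => v s p i := by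
  intro c
  have : IsManifold (𝓡 2) 2 M := IsManifold.of_le (n := ∞) (by exact ENat.LEInfty.out)
  have h1 : ContMDiffOn (𝓘(ℝ, ℝ).prod (𝓡 2)) (𝓘(ℝ, ℝ).prod (𝓡 2)) 2
      (fun q : ℝ × 𝔼 => (q.1, (chartAt 𝔼 c).symm q.2)) (Ioi 0 ×ˢ (chartAt 𝔼 c).target) :=
    contMDiffOn_fst.prodMk ((contMDiffOn_chart_symm (I := 𝓡 2) (n := 2) (x := c)).comp
      contMDiffOn_snd fun q hq => hq.2)
  have h2 := hv.comp h1 fun q hq => ⟨hq.1, mem_univ _⟩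
  rw [← modelWithCornersSelf_prod, chartedSpaceSelf_prod] at h2
  have h3 := contMDiffOn_iff_contDiffOn.1 h2
  exact (EuclideanSpace.proj (𝕜 := ℝ) i).contDiff.comp_contDiffOn h3

end TimeDependent

/-! ### Differentiation of the energy along the flow -/

section Flow

variable {M : Type*} [TopologicalSpace M] [ChartedSpace 𝔼 M] [IsManifold (𝓡 2) ∞ M]
  (g : SmoothMetric (𝓡 2) M)

theorem energyDensity_eq_scalarEnergy (ε : ℝ) (u : M → 𝔼) :
    energyDensity g ε u = scalarEnergy g ε fun i p => u p i := by
  funext p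
  rw [energyDensity, scalarEnergy, gradSq, EuclideanSpace.real_norm_sq_eq]

theorem hasDerivAt_scalarEnergy (ε : ℝ) {f : Fin 2 → ℝ → M → ℝ} (hf : ∀ i, TimeContDiff 2 (f i))
    {s : ℝ} (hs : 0 < s) (p : M) :
    HasDerivAt (fun r => scalarEnergy g ε (fun i => f i r) p)
      (∑ i, (g.inner p (grad g (f i s) p) (grad g (fun q => deriv (fun r => f i r q) s) p)
        - (1 - ∑ j, f j s p ^ 2) / ε ^ 2 * f i s p * deriv (fun r => f i r p) s)) s := by
  have h1 := fun i => (hf i).hasDerivAt_inner_grad_grad g hs p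
  have h2 := fun i => (hf i).hasDerivAt (by simp) hs p
  simp only [scalarEnergy, Fin.sum_univ_two]
  have h3 := (((h1 0).fun_add (h1 1)).div_const 2).fun_add
    ((((((h2 0).fun_pow 2).fun_add ((h2 1).fun_pow 2)).const_sub 1).fun_pow 2).div_const
      (4 * ε ^ 2))
  refine h3.congr_deriv ?_
  simp
  ring

theorem timeContDiff_scalarEnergy_deriv (ε : ℝ) {f : Fin 2 → ℝ → M → ℝ}
    (hf : ∀ i, TimeContDiff 2 (f i)) :
    TimeContDiff 0 fun s p =>
      ∑ i, (g.inner p (grad g (f i s) p) (grad g (fun q => deriv (fun r => f i r q) s) p)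
        - (1 - ∑ j, f j s p ^ 2) / ε ^ 2 * f i s p * deriv (fun r => f i r p) s) := by
  intro c
  have h1 := fun i => ((hf i).of_le one_le_two).inner_grad_grad (k := 0) g
    (TimeContDiff.timeDeriv (k := 1) (hf i)) c
  have h2 := fun i => (hf i).of_le (l := 0) (by simp) c
  have h3 := fun i => (TimeContDiff.timeDeriv (k := 1) (hf i)).of_le (l := 0) (by simp) c
  exact ContDiffOn.sum fun i _ => (h1 i).sub ((((contDiffOn_const.sub
    (ContDiffOn.sum fun j _ => (h2 j).pow 2)).div_const _).mul (h2 i)).mul (h3 i))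

variable [T2Space M] [CompactSpace M] [MeasurableSpace M] [BorelSpace M]

/-- Differentiation of the weighted energy under the integral sign. The derivative of the
integrand is continuous on `(0, ∞) × M`, hence bounded near `t` by compactness of `M`. -/
theorem hasDerivAt_integral_scalarEnergy (ε : ℝ) {f : Fin 2 → ℝ → M → ℝ}
    (hf : ∀ i, TimeContDiff 2 (f i)) {η : M → ℝ} (hη : Continuous η) {t : ℝ} (ht : 0 < t) :
    HasDerivAt (fun s => ∫ p, η p * scalarEnergy g ε (fun i => f i s) p ∂(vol g))
      (∫ p, η p * ∑ i, (g.inner p (grad g (f i t) p)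
          (grad g (fun q => deriv (fun r => f i r q) t) p)
        - (1 - ∑ j, f j t p ^ 2) / ε ^ 2 * f i t p * deriv (fun r => f i r p) t) ∂(vol g)) t := by
  have := isFiniteMeasure_vol g
  have hG := timeContDiff_scalarEnergy_deriv g ε hf
  set G : ℝ → M → ℝ := fun s p =>
    ∑ i, (g.inner p (grad g (f i s) p) (grad g (fun q => deriv (fun r => f i r q) s) p)
        - (1 - ∑ j, f j s p ^ 2) / ε ^ 2 * f i s p * deriv (fun r => f i r p) s) with hGdef
  have hFc : ∀ s, 0 < s → Continuous fun p => η p * scalarEnergy g ε (fun i => f i s) p :=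
    fun s hs => hη.mul (contMDiff_scalarEnergy g ε fun i => (hf i).contMDiff hs).continuous
  have hGc : Continuous (G t) := (hG.contMDiff ht).continuous
  -- A compact time interval around `t` on which the flow is `C²`.
  have hKs : Icc (t / 2) (2 * t) ×ˢ (univ : Set M) ⊆ Ioi 0 ×ˢ univ :=
    prod_mono (fun s hs => lt_of_lt_of_le (by positivity) hs.1) subset_rfl
  have hcontOn : ContinuousOn (fun q : ℝ × M => η q.2 * G q.1 q.2)
      (Icc (t / 2) (2 * t) ×ˢ univ) :=
    (hη.comp continuous_snd).continuousOn.mul (hG.continuousOn.mono hKs)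
  obtain ⟨C, hC⟩ := (isCompact_Icc.prod isCompact_univ).exists_bound_of_continuousOn hcontOn
  refine (hasDerivAt_integral_of_dominated_loc_of_deriv_le (s := Ioo (t / 2) (2 * t))
    (F' := fun s p => η p * G s p) (bound := fun _ => C)
    (Ioo_mem_nhds (by linarith) (by linarith)) ?_ ?_ ?_ ?_ ?_ ?_).2
  · filter_upwards [Ioi_mem_nhds ht] with s hs
    exact (hFc s hs).aestronglyMeasurable
  · exact integrable_vol_of_continuous g (hFc t ht)
  · exact (hη.mul hGc).aestronglyMeasurable
  · exact Filter.Eventually.of_forall fun p s hs =>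
      hC (s, p) ⟨Ioo_subset_Icc_self hs, mem_univ _⟩
  · exact integrable_const C
  · exact Filter.Eventually.of_forall fun p s hs =>
      (hasDerivAt_scalarEnergy g ε hf (lt_trans (by positivity) hs.1) p).const_mul (η p)

end Flow

end Riem

end
theorem mainTheorem11 {M : Type*} [TopologicalSpace M]
    [ChartedSpace (EuclideanSpace ℝ (Fin 2)) M] [IsManifold (𝓡 2) ∞ M]
    [T2Space M] [CompactSpace M] [SimplyConnectedSpace M]
    [MeasurableSpace M] [BorelSpace M]
    (g : Riem.SmoothMetric (𝓡 2) M)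
    (ε : ℝ) (hε : 0 < ε) (hε1 : ε ≠ 1)
    (u₀ : M → EuclideanSpace ℝ (Fin 2)) (v : ℝ → M → EuclideanSpace ℝ (Fin 2))
    (hv : Riem.IsRescaledGLSolution g ε u₀ v)
    (η : M → ℝ) (hη : ContMDiff (𝓡 2) 𝓘(ℝ, ℝ) ∞ η)
    (t : ℝ) (ht : 0 < t) :
    Integrable (fun p => η p * Riem.energyDensity g ε (v t) p) (Riem.vol g) ∧
    Integrable (fun p => Riem.hessGrad g η (v t) p - Riem.laplace g η p * Riem.energyDensity g ε (v t) p)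
      (Riem.vol g) ∧
    Integrable (fun p => η p * ‖deriv (fun s => v s p) t‖ ^ 2) (Riem.vol g) ∧
    HasDerivAt (fun s => ∫ p, η p * Riem.energyDensity g ε (v s) p ∂(Riem.vol g))
      (|Real.log ε| * ∫ p, (Riem.hessGrad g η (v t) p - Riem.laplace g η p * Riem.energyDensity g ε (v t) p)
          ∂(Riem.vol g)
        - 1 / |Real.log ε| * ∫ p, η p * ‖deriv (fun s => v s p) t‖ ^ 2 ∂(Riem.vol g)) t := by

  have hL : |Real.log ε| ≠ 0 :=
    abs_ne_zero.2 (Real.log_ne_zero_of_pos_of_ne_one hε hε1)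
  have hT := fun i => Riem.timeContDiff_component hv.contMDiffOn i
  have hT' := fun i => Riem.TimeContDiff.timeDeriv (k := 1) (hT i)
  have hη2 : ContMDiff (𝓡 2) 𝓘(ℝ, ℝ) 2 η := hη.of_le (by exact ENat.LEInfty.out)
  have hw := fun i => (hT i).contMDiff ht
  have hw' := fun i => (hT' i).contMDiff ht
  have he : Continuous (Riem.energyDensity g ε (v t)) := by
    rw [Riem.energyDensity_eq_scalarEnergy]
    exact (Riem.contMDiff_scalarEnergy g ε hw).continuous
  have hd : ∀ p, ‖deriv (fun s => v s p) t‖ ^ 2 = ∑ i, deriv (fun s => v s p i) t ^ 2 := by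
    intro p
    simp only [EuclideanSpace.real_norm_sq_eq, Riem.deriv_apply_of_timeContDiff hT ht]
  have heq : ∀ i p, 1 / |Real.log ε| * deriv (fun s => v s p i) t -
      Riem.laplace g (fun q => v t q i) p =
        (1 - ∑ j, v t p j ^ 2) / ε ^ 2 * v t p i := by
    intro i p
    have h := congrArg (fun z : EuclideanSpace ℝ (Fin 2) => z i) (hv.equation t ht p)
    simpa [Riem.vecLaplace, Riem.deriv_apply_of_timeContDiff hT ht,
      EuclideanSpace.real_norm_sq_eq] using h
  refine ⟨Riem.integrable_vol_of_continuous g (hη.continuous.mul he),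
    Riem.integrable_vol_of_continuous g ?_, Riem.integrable_vol_of_continuous g ?_, ?_⟩
  · exact (continuous_finsetSum _ fun i _ => Riem.continuous_inner_hess_grad g hη2 (hw i)).sub
      ((Riem.continuous_laplace g hη2).mul he)
  · simp only [hd]
    exact hη.continuous.mul (continuous_finsetSum _ fun i _ => (hw' i).continuous.pow 2)
  · have h1 := Riem.hasDerivAt_integral_scalarEnergy g ε hT hη.continuous ht
    rw [Riem.integral_energy_derivative g hL hη2 hw hw' heq] at h1
    simp only [hd, Riem.energyDensity_eq_scalarEnergy]
    exact h1
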